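/- For a finite simple graph $\Gamma$ of order $n$, a symmetric $n\times n$ matrix $M$ over $\mathbb{F}_2$, with rows and columns indexed by the vertices of $\Gamma$, represents $\Gamma$ if for all distinct vertices $i,j$ one has $M_{ij}=0$ exactly when $i$ and $j$ are not adjacent (the diagonal entries are arbitrary). Let $\mathcal{G}$ be the class of finite connected graphs having a vertex $x$ such that the subgraph induced on the remaining vertices is a path with at least one vertex. For $d\ge 1$ and integers $t_0,t_d\ge 0$ and $t_1,\dots,t_{d-1}\ge 1$, let $\Gamma(t_0,t_1,\dots,t_d)$ be the graph that consists of a path $x_1x_2\cdots x_{n-1}$ with $n-1=t_0+t_1+\dots+t_d+1$ vertices, as an induced subgraph, and one further vertex $x$ with exactly $d$ neighbours, which, listed in the order of the path, are such that there are $t_0$ edges of the path between $x_1$ and the first neighbour of $x$, $t_i$ edges between the $i$-th and the $(i+1)$-th neighbour of $x$ for $1\le i\le d-1$, and $t_d$ edges between the last neighbour of $x$ and $x_{n-1}$. **Theorem.** A graph $\Gamma$ of order $n$ belongs to $\mathcal{G}$ and is represented by more matrices over $\mathbb{F}_2$ of rank $n-1$ than of rank $n$ if and only if it is isomorphic to one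 of the following graphs: 1. $\Gamma(0,s,t)$ with $s\ge 1$, $t\ge 0$ and $\min(s,t)$ even; 2. $\Gamma(s,2,t)$ with $s,t\ge 1$ and $\min(s,t)$ even; 3. $\Gamma(0,s,1,t)$ with $s,t\ge 1$ and $\min(s,t)$ odd; 4. $\Gamma(s,1,1,t)$ with $s,t\ge 1$ and $\min(s,t)$ even; 5. $\Gamma(0,s,2,t,0)$ with $s,t\ge 1$ and $\min(s,t)$ even; 6. $\Gamma(0,s,1,1,t,0)$ with $s,t\ge 1$ and $\min(s,t)$ even. -/

import Mathlib

/-- A square matrix `M`, with rows and columns indexed by the vertices of `Γ`, represents `Γ` if it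
is symmetric and its off-diagonal entries are nonzero exactly at the edges of `Γ`. The diagonal
entries are arbitrary. -/
def Represents {V F : Type*} [Field F] (M : Matrix V V F) (Γ : SimpleGraph V) : Prop :=
  M.IsSymm ∧ ∀ i j : V, i ≠ j → (M i j = 0 ↔ ¬ Γ.Adj i j)

/-- `rankCount Γ k` is the number of matrices of rank `k` over the field of two elements that
represent `Γ`. -/
noncomputable def rankCount {V : Type*} [Fintype V] (Γ : SimpleGraph V) (k : ℕ) : ℕ :=
  Nat.card {M : Matrix V V (ZMod 2) // Represents M Γ ∧ M.rank = k}

/-- The class of connected graphs that have a (nonempty) path on all but one of their vertices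
as an induced subgraph. -/
def InClassG {V : Type*} (Γ : SimpleGraph V) : Prop :=
  Γ.Connected ∧ ∃ (x : V) (m : ℕ), 1 ≤ m ∧
    Nonempty (SimpleGraph.pathGraph m ≃g Γ.induce {y : V | y ≠ x})

/-- For `t = [t₀, …, t_d]`, the positions `t₀, t₀ + t₁, …, t₀ + ⋯ + t_{d-1}`, counted from `0`
along the path, of the neighbours of the extra vertex. -/
def IsNbrPosition (t : List ℕ) (p : ℕ) : Prop :=
  ∃ i : ℕ, i + 1 < t.length ∧ p = (t.take (i + 1)).sum

/-- The graph `Γ(t₀, …, t_d)`: the vertices `some p`, `0 ≤ p ≤ t₀ + ⋯ + t_d`, form an induced path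
in their natural order, and the extra vertex `x = none` is adjacent to exactly `d` of them, in such
a way that the path has `t₀` edges before the first neighbour of `x`, `t_i` edges between the
`i`-th and the `(i+1)`-th neighbour for `1 ≤ i ≤ d - 1`, and `t_d` edges after the last neighbour.
(It is only used with `t₁, …, t_{d-1} ≥ 1`.) -/
def gapGraph (t : List ℕ) : SimpleGraph (Option (Fin (t.sum + 1))) where
  Adj a b :=
    match a, b with
    | none, none => False
    | none, some p => IsNbrPosition t p
    | some p, none => IsNbrPosition t p
    | some p, some q => (SimpleGraph.pathGraph (t.sum + 1)).Adj p q
  symm := ⟨by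
    rintro (_ | p) (_ | q) h
    · exact h
    · exact h
    · exact h
    · exact SimpleGraph.Adj.symm h⟩
  loopless := ⟨by
    rintro (_ | p) h
    · exact h
    · exact SimpleGraph.irrefl _ h⟩

/-- `Γ` is (isomorphic to) the graph `Γ(t₀, …, t_d)`. -/
def IsGamma {V : Type*} (Γ : SimpleGraph V) (t : List ℕ) : Prop :=
  Nonempty (Γ ≃g gapGraph t)

/-!
Let `Γ` be a cone over the path on `m = n - 1` vertices, `v` the indicator vector of the neighbours
of the extra vertex, and fix the diagonal entries of the path, which gives a tridiagonal matrix `N`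
over the field of two elements. Bordering `N` by `v` and one of the two corner entries gives the
matrices representing `Γ`. If `N` is invertible, one corner entry gives rank `n` and the other
`n - 1`. Otherwise `N` has a kernel `{0, u}`; if `u · v = 1`, both corner entries give rank `n`, and
if `u · v = 0`, one gives rank `n - 1` and the other a smaller rank (`sum_corankSign_of_injective`,
`sum_corankSign_of_dotProduct_ne`, `sum_corankSign_of_dotProduct_eq`). So the excess of rank `n - 1`
over rank `n` is half of `3 S - T`, where `T` is the number of singular `N` and `S` is their number
counted with the signs `(-1) ^ (u · v)` (`two_mul_rankCount_sub`).

The kernel vector `u` is computed along the path by a three-term recurrence. Summing over the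
diagonal one vertex at a time, `S` becomes the last value of the recurrence
`f (k + 2) = σ (k + 1) * (f (k + 1) + 2 * f k)`, where `σ k = -1` at the neighbours of the extra
vertex and `σ k = 1` elsewhere (`signedCount_zero_add_two`); `T` is the value for constant `σ`,
namely `(2 ^ m - (-1) ^ m) / 3`. The question is for which sign sequences `3 S > T`.

The signs at the two ends only multiply `S` by a sign. Let the first negative sign in the interior
be given. After three steps from there the state of the recurrence is, up to sign, `(F, ±1)` with
`F` about four times the value before, whatever the two following signs are (`transfer_first_neg`).
Positive signs would have given about eight times the value, with half of this as the second
component of the state. On positive signs the sum of the two components governs the growth, so a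
third of the extremal value is left. A further negative sign in the interior, except within these
three steps, at least halves the result asymptotically, and the sequence falls below the bound
(`three_mul_abs_transfer_le_of_neg`,
`nine_mul_abs_transfer_le`). Hence the interior has no negative sign or one of the four patterns
`-`, `--`, `-+-`, `---` (`IsLarge.interior_cases`). For these patterns `S` is a third of `T` up to
sign and oscillating terms of lower order, whose sign is decided by the parity of the smaller of the
distances to the two ends (`min_even_dichotomy`); this gives the six families.
-/

/-! ### Ranks of bordered matrices over the field of two elements -/

section LinearAlgebra

open Matrix

variable {ι : Type*}

lemma zmod_two_eq_zero_or_one (e : ZMod 2) : e = 0 ∨ e = 1 := by decide +revert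

lemma sum_zmod_two {A : Type*} [AddCommMonoid A] (g : ZMod 2 → A) (f : ZMod 2) :
    ∑ c, g c = g (f + 1) + g f := by
  have : (Finset.univ : Finset (ZMod 2)) = {f + 1, f} := by decide +revert
  rw [this, Finset.sum_pair (by decide +revert)]

lemma ext_none_some {z z' : Option ι → ZMod 2} (h0 : z none = z' none)
    (h : (fun i => z (some i)) = fun i => z' (some i)) : z = z' := by
  funext o
  cases o with
  | none => exact h0
  | some i => exact congrFun h i

variable [Fintype ι]

lemma rank_eq_card_iff_ker_trivial (M : Matrix ι ι (ZMod 2)) :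
    M.rank = Fintype.card ι ↔ ∀ z, M *ᵥ z = 0 → z = 0 := by
  have h := M.mulVecLin.finrank_range_add_finrank_ker
  rw [Module.finrank_fintype_fun_eq_card] at h
  have hr : M.rank = Module.finrank (ZMod 2) (LinearMap.range M.mulVecLin) := rfl
  have : M.rank = Fintype.card ι ↔ Module.finrank (ZMod 2) (LinearMap.ker M.mulVecLin) = 0 := by
    omega
  rw [this, Submodule.finrank_eq_zero, LinearMap.ker_eq_bot']
  simp

lemma rank_add_one_eq_card_iff (M : Matrix ι ι (ZMod 2)) {z₀ : ι → ZMod 2} (hz₀ : z₀ ≠ 0)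
    (hM : M *ᵥ z₀ = 0) :
    M.rank + 1 = Fintype.card ι ↔ ∀ z, M *ᵥ z = 0 → z = 0 ∨ z = z₀ := by
  have h := M.mulVecLin.finrank_range_add_finrank_ker
  rw [Module.finrank_fintype_fun_eq_card] at h
  have hr : M.rank = Module.finrank (ZMod 2) (LinearMap.range M.mulVecLin) := rfl
  have : M.rank + 1 = Fintype.card ι ↔
      Module.finrank (ZMod 2) (LinearMap.ker M.mulVecLin) = 1 := by
    omega
  rw [this, finrank_eq_one_iff_of_nonzero' (⟨z₀, by simpa using hM⟩ : LinearMap.ker M.mulVecLin)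
    (by simpa using hz₀)]
  constructor
  · intro H z hz
    obtain ⟨c, hc⟩ := H ⟨z, by simpa using hz⟩
    have hc' : c • z₀ = z := congrArg Subtype.val hc
    rcases zmod_two_eq_zero_or_one c with rfl | rfl
    · left; rw [← hc', zero_smul]
    · right; rw [← hc', one_smul]
  · rintro H ⟨z, hz⟩
    rcases H z (by simpa using hz) with rfl | rfl
    · exact ⟨0, by ext; simp⟩
    · exact ⟨1, by ext; simp⟩

/-- The symmetric matrix obtained from `N` by bordering it with the row and column `v` and the
corner entry `c`; the new index is `none`. -/
def borderedMatrix (N : Matrix ι ι (ZMod 2)) (v : ι → ZMod 2) (c : ZMod 2) :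
    Matrix (Option ι) (Option ι) (ZMod 2)
  | none, none => c
  | none, some j => v j
  | some i, none => v i
  | some i, some j => N i j

variable {N : Matrix ι ι (ZMod 2)} {v : ι → ZMod 2} {c : ZMod 2}

lemma borderedMatrix_mulVec_eq_zero_iff {z : Option ι → ZMod 2} :
    borderedMatrix N v c *ᵥ z = 0 ↔
      c * z none + v ⬝ᵥ (fun i => z (some i)) = 0 ∧
        N *ᵥ (fun i => z (some i)) = z none • v := by
  rw [funext_iff, Option.forall]
  have h1 : (borderedMatrix N v c *ᵥ z) none = c * z none + v ⬝ᵥ (fun i => z (some i)) := by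
    simp [mulVec, dotProduct, Fintype.sum_option, borderedMatrix]
  have h2 : ∀ i, (borderedMatrix N v c *ᵥ z) (some i) =
      v i * z none + (N *ᵥ (fun i => z (some i))) i := by
    intro i
    simp [mulVec, dotProduct, Fintype.sum_option, borderedMatrix]
  rw [h1]
  refine and_congr Iff.rfl ?_
  rw [funext_iff]
  refine forall_congr' fun i => ?_
  rw [h2]
  simp only [Pi.zero_apply, Pi.smul_apply, smul_eq_mul]
  generalize (N *ᵥ (fun i => z (some i))) i = a
  generalize v i = b
  generalize z none = e
  decide +revert

/-- The contribution of a matrix of size `m + 1` to the excess of rank `m` over rank `m + 1`: `1` for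
corank one, `-1` for corank zero, and `0` for larger corank. -/
noncomputable def corankSign (M : Matrix (Option ι) (Option ι) (ZMod 2)) : ℤ :=
  (if M.rank = Fintype.card ι then 1 else 0) - (if M.rank = Fintype.card ι + 1 then 1 else 0)

lemma corankSign_of_ker_trivial {M : Matrix (Option ι) (Option ι) (ZMod 2)}
    (h : ∀ z, M *ᵥ z = 0 → z = 0) : corankSign M = -1 := by
  have := (rank_eq_card_iff_ker_trivial M).2 h
  rw [Fintype.card_option] at this
  simp [corankSign, this]

lemma corankSign_of_ker_pair {M : Matrix (Option ι) (Option ι) (ZMod 2)} {z₀} (hz₀ : z₀ ≠ 0)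
    (hM : M *ᵥ z₀ = 0) (h : ∀ z, M *ᵥ z = 0 → z = 0 ∨ z = z₀) : corankSign M = 1 := by
  have := (rank_add_one_eq_card_iff M hz₀ hM).2 h
  rw [Fintype.card_option, Nat.add_right_cancel_iff] at this
  simp [corankSign, this]

lemma corankSign_of_ker_large {M : Matrix (Option ι) (Option ι) (ZMod 2)} {z₀ z₁}
    (hz₀ : z₀ ≠ 0) (hM₀ : M *ᵥ z₀ = 0) (hz₁ : z₁ ≠ 0) (hM₁ : M *ᵥ z₁ = 0) (hne : z₁ ≠ z₀) :
    corankSign M = 0 := by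
  have h1 : ¬ M.rank = Fintype.card ι := by
    intro h
    have := (rank_add_one_eq_card_iff M hz₀ hM₀).1 (by rw [Fintype.card_option, h]) z₁ hM₁
    tauto
  have h2 : ¬ M.rank = Fintype.card ι + 1 := by
    intro h
    exact hz₀ ((rank_eq_card_iff_ker_trivial M).1 (by rw [Fintype.card_option, h]) z₀ hM₀)
  simp [corankSign, h1, h2]

/-- If `N` is invertible, the determinant of the bordered matrix is a nonconstant affine function
of the corner entry, so the two corner entries give coranks zero and one. -/
lemma sum_corankSign_of_injective (hN : ∀ y, N *ᵥ y = 0 → y = 0) :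
    ∑ c, corankSign (borderedMatrix N v c) = 0 := by
  have hinj : Function.Injective N.mulVecLin := by
    rw [← LinearMap.ker_eq_bot, LinearMap.ker_eq_bot']
    simpa using hN
  obtain ⟨w, hw⟩ := LinearMap.injective_iff_surjective.1 hinj v
  replace hw : N *ᵥ w = v := by simpa using hw
  have key : ∀ c (z : Option ι → ZMod 2), borderedMatrix N v c *ᵥ z = 0 →
      (fun i => z (some i)) = z none • w ∧ z none * (c + v ⬝ᵥ w) = 0 := by
    intro c z hz
    rw [borderedMatrix_mulVec_eq_zero_iff] at hz
    have h1 : (fun i => z (some i)) = z none • w := by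
      apply hinj
      simp [hz.2, hw]
    refine ⟨h1, ?_⟩
    rw [h1, dotProduct_smul, smul_eq_mul] at hz
    linear_combination hz.1
  have hA : corankSign (borderedMatrix N v (v ⬝ᵥ w + 1)) = -1 := by
    refine corankSign_of_ker_trivial fun z hz => ?_
    obtain ⟨h1, h2⟩ := key _ z hz
    have h0 : z none = 0 := by
      generalize z none = e at h2
      generalize v ⬝ᵥ w = f at h2
      clear * - h2
      revert h2 e f
      decide
    refine ext_none_some (by simpa using h0) ?_
    rw [h1, h0, zero_smul]; rfl
  have hB : corankSign (borderedMatrix N v (v ⬝ᵥ w)) = 1 := by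
    refine corankSign_of_ker_pair (z₀ := fun o => o.elim 1 w) ?_ ?_ fun z hz => ?_
    · intro h
      simpa using congrFun h none
    · rw [borderedMatrix_mulVec_eq_zero_iff]
      refine ⟨?_, by simp [hw]⟩
      simp only [Option.elim]
      generalize v ⬝ᵥ w = f
      decide +revert
    · obtain ⟨h1, -⟩ := key _ z hz
      rcases zmod_two_eq_zero_or_one (z none) with h0 | h0
      · left
        refine ext_none_some (by simpa using h0) ?_
        rw [h1, h0, zero_smul]; rfl
      · right
        refine ext_none_some (by simpa using h0) ?_
        rw [h1, h0, one_smul]; rfl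
  rw [sum_zmod_two _ (v ⬝ᵥ w), hA, hB]
  norm_num

/-- If `N` has the kernel `{0, u}` and `u` is not orthogonal to `v`, the bordered matrix is
invertible for both corner entries. -/
lemma sum_corankSign_of_dotProduct_ne (hsymm : N.IsSymm) {u : ι → ZMod 2} (hu : N *ᵥ u = 0)
    (hker : ∀ y, N *ᵥ y = 0 → y = 0 ∨ y = u) (huv : v ⬝ᵥ u ≠ 0) :
    ∑ c, corankSign (borderedMatrix N v c) = -2 := by
  have key : ∀ c, corankSign (borderedMatrix N v c) = -1 := by
    intro c
    refine corankSign_of_ker_trivial fun z hz => ?_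
    rw [borderedMatrix_mulVec_eq_zero_iff] at hz
    obtain ⟨h1, h2⟩ := hz
    have h0 : z none = 0 := by
      have h3 : u ⬝ᵥ (N *ᵥ (fun i => z (some i))) = 0 := by
        rw [dotProduct_mulVec, ← mulVec_transpose, hsymm.eq, hu, zero_dotProduct]
      rw [h2, dotProduct_smul, dotProduct_comm, smul_eq_mul, mul_eq_zero] at h3
      exact h3.resolve_right huv
    rw [h0, zero_smul] at h2
    refine ext_none_some (by simpa using h0) ?_
    rcases hker _ h2 with h | h
    · rw [h]; rfl
    · rw [h0, h] at h1
      simp [huv] at h1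
  simp [key]

/-- If `N` has the kernel `{0, u}` and `u` is orthogonal to `v`, one corner entry gives corank one
and the other corank two. -/
lemma sum_corankSign_of_dotProduct_eq (hsymm : N.IsSymm) {u : ι → ZMod 2} (hu0 : u ≠ 0)
    (hu : N *ᵥ u = 0) (hker : ∀ y, N *ᵥ y = 0 → y = 0 ∨ y = u) (huv : v ⬝ᵥ u = 0) :
    ∑ c, corankSign (borderedMatrix N v c) = 1 := by
  -- The range of the symmetric matrix `N` is the orthogonal complement of its kernel.
  obtain ⟨w, hw⟩ : ∃ w, N *ᵥ w = v := by
    let φ : (ι → ZMod 2) →ₗ[ZMod 2] ZMod 2 := dotProductBilin (ZMod 2) (ZMod 2) u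
    have hle : LinearMap.range N.mulVecLin ≤ LinearMap.ker φ := by
      rintro _ ⟨y, rfl⟩
      change u ⬝ᵥ (N *ᵥ y) = 0
      rw [dotProduct_mulVec, ← mulVec_transpose, hsymm.eq, hu, zero_dotProduct]
    have hφ : Function.Surjective φ := by
      obtain ⟨i, hi⟩ := Function.ne_iff.1 hu0
      classical
      intro a
      refine ⟨Pi.single i ((u i)⁻¹ * a), ?_⟩
      change u ⬝ᵥ _ = a
      rw [dotProduct_single, mul_inv_cancel_left₀ hi]
    have h1 := (rank_add_one_eq_card_iff N hu0 hu).2 hker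
    have hr : N.rank = Module.finrank (ZMod 2) (LinearMap.range N.mulVecLin) := rfl
    have h2 := φ.finrank_range_add_finrank_ker
    rw [LinearMap.range_eq_top.2 hφ, finrank_top, Module.finrank_self,
      Module.finrank_fintype_fun_eq_card] at h2
    have heq := Submodule.eq_of_le_of_finrank_eq hle (by omega)
    have hv : v ∈ LinearMap.range N.mulVecLin := by
      rw [heq]
      change u ⬝ᵥ v = 0
      rwa [dotProduct_comm]
    simpa using hv
  have hz₀ : (fun o : Option ι => o.elim 0 u) ≠ 0 := by
    intro h
    exact hu0 (funext fun i => congrFun h (some i))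
  have hM₀ : ∀ c, borderedMatrix N v c *ᵥ (fun o : Option ι => o.elim 0 u) = 0 := by
    intro c
    rw [borderedMatrix_mulVec_eq_zero_iff]
    simp [huv, hu]
  have hA : corankSign (borderedMatrix N v (v ⬝ᵥ w + 1)) = 1 := by
    refine corankSign_of_ker_pair hz₀ (hM₀ _) fun z hz => ?_
    rw [borderedMatrix_mulVec_eq_zero_iff] at hz
    obtain ⟨h1, h2⟩ := hz
    have h3 : N *ᵥ ((fun i => z (some i)) - z none • w) = 0 := by
      rw [mulVec_sub, h2, mulVec_smul, hw, sub_self]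
    have h4 : v ⬝ᵥ ((fun i => z (some i)) - z none • w) = 0 := by
      rcases hker _ h3 with h | h <;> rw [h]
      · simp
      · exact huv
    rw [dotProduct_sub, dotProduct_smul, smul_eq_mul] at h4
    have h0 : z none = 0 := by
      generalize z none = e at h1 h4
      generalize v ⬝ᵥ w = f at h1 h4
      generalize v ⬝ᵥ _ = g at h1 h4
      clear * - h1 h4
      revert h1 h4 e f g
      decide
    rw [h0, zero_smul, sub_zero] at h3
    rcases hker _ h3 with h | h
    · exact Or.inl (ext_none_some (by simpa using h0) (by rw [h]; rfl))
    · exact Or.inr (ext_none_some (by simpa using h0) (by rw [h]; rfl))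
  have hB : corankSign (borderedMatrix N v (v ⬝ᵥ w)) = 0 := by
    refine corankSign_of_ker_large (z₁ := fun o => o.elim 1 w) hz₀ (hM₀ _) ?_ ?_ ?_
    · intro h
      simpa using congrFun h none
    · rw [borderedMatrix_mulVec_eq_zero_iff]
      refine ⟨?_, by simp [hw]⟩
      simp only [Option.elim]
      generalize v ⬝ᵥ w = f
      decide +revert
    · intro h
      simpa using congrFun h none
  rw [sum_zmod_two _ (v ⬝ᵥ w), hA, hB]
  norm_num

end LinearAlgebra

/-! ### Matrices representing a cone over a path -/

/-- The matrix over the field of two elements that represents `Γ` and has the diagonal `d`. -/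
noncomputable def repMatrix {V : Type*} (Γ : SimpleGraph V) (d : V → ZMod 2) :
    Matrix V V (ZMod 2) :=
  open Classical in fun i j => if i = j then d i else if Γ.Adj i j then 1 else 0

lemma represents_repMatrix {V : Type*} (Γ : SimpleGraph V) (d : V → ZMod 2) :
    Represents (repMatrix Γ d) Γ := by
  constructor
  · ext i j
    by_cases h : i = j
    · subst h; rfl
    · by_cases ha : Γ.Adj i j
      · simp [repMatrix, h, Ne.symm h, ha, ha.symm]
      · simp [repMatrix, h, Ne.symm h, ha, show ¬ Γ.Adj j i from fun h' => ha h'.symm]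
  · intro i j h
    simp [repMatrix, h]

lemma Represents.eq_repMatrix {V : Type*} {Γ : SimpleGraph V} {M : Matrix V V (ZMod 2)}
    (h : Represents M Γ) : M = repMatrix Γ M.diag := by
  ext i j
  by_cases hij : i = j
  · subst hij; simp [repMatrix]
  · have := h.2 i j hij
    by_cases ha : Γ.Adj i j
    · rcases zmod_two_eq_zero_or_one (M i j) with h0 | h1
      · exact absurd ha (this.1 h0)
      · simp [repMatrix, hij, ha, h1]
    · simp [repMatrix, hij, ha, this.2 ha]

lemma rankCount_eq_card_diagonals {V : Type*} [Fintype V] (Γ : SimpleGraph V) (k : ℕ) :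
    rankCount Γ k = Nat.card {d : V → ZMod 2 // (repMatrix Γ d).rank = k} := by
  refine Nat.card_congr
    { toFun := fun M => ⟨M.1.diag, by rw [← M.2.1.eq_repMatrix]; exact M.2.2⟩
      invFun := fun d => ⟨repMatrix Γ d.1, represents_repMatrix Γ d.1, d.2⟩
      left_inv := fun M => Subtype.ext M.2.1.eq_repMatrix.symm
      right_inv := fun d => Subtype.ext ?_ }
  funext i
  simp [repMatrix]

lemma rankCount_congr {V W : Type*} [Fintype V] [Fintype W] {Γ : SimpleGraph V}
    {Δ : SimpleGraph W} (e : Γ ≃g Δ) (k : ℕ) : rankCount Γ k = rankCount Δ k := by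
  classical
  have he : ∀ i, e.toEquiv.symm (e i) = i := e.toEquiv.symm_apply_apply
  refine Nat.card_congr ((Matrix.reindex e.toEquiv e.toEquiv).subtypeEquiv fun M => ?_)
  rw [Matrix.rank_reindex]
  refine and_congr_left' ?_
  unfold Represents
  constructor
  · rintro ⟨h1, h2⟩
    refine ⟨h1.submatrix _, fun i j hij => ?_⟩
    have := h2 (e.symm i) (e.symm j) (by simpa using hij)
    rw [e.symm.map_adj_iff] at this
    exact this
  · rintro ⟨h1, h2⟩
    refine ⟨?_, fun i j hij => ?_⟩
    · ext i j
      have := h1.apply (e i) (e j)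
      simp only [Matrix.reindex_apply, Matrix.submatrix_apply] at this
      rwa [he, he] at this
    · have := h2 (e i) (e j) (by simpa using hij)
      rw [e.map_adj_iff] at this
      simp only [Matrix.reindex_apply, Matrix.submatrix_apply] at this
      rwa [he, he] at this

/-- The graph consisting of the induced path `some 0, …, some (m - 1)` and the further vertex
`none`, whose neighbours are the `some p` for which `v p` holds. -/
def coneGraph (m : ℕ) (v : ℕ → Prop) : SimpleGraph (Option (Fin m)) where
  Adj a b :=
    match a, b with
    | none, none => False
    | none, some p => v p
    | some p, none => v p
    | some p, some q => (SimpleGraph.pathGraph m).Adj p q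
  symm := ⟨by
    rintro (_ | p) (_ | q) h
    · exact h
    · exact h
    · exact h
    · exact SimpleGraph.Adj.symm h⟩
  loopless := ⟨by
    rintro (_ | p) h
    · exact h
    · exact SimpleGraph.irrefl _ h⟩

open Classical in
/-- The indicator function of `v` with values in the field of two elements. -/
noncomputable def indicatorTwo (v : ℕ → Prop) (k : ℕ) : ZMod 2 := if v k then 1 else 0

lemma repMatrix_coneGraph (m : ℕ) (v : ℕ → Prop) (d : Option (Fin m) → ZMod 2) :
    repMatrix (coneGraph m v) d =
      borderedMatrix (repMatrix (SimpleGraph.pathGraph m) fun p => d (some p))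
        (fun p => indicatorTwo v p) (d none) := by
  ext (_ | p) (_ | q)
  · simp [repMatrix, borderedMatrix]
  · by_cases h : v q <;> simp [repMatrix, borderedMatrix, coneGraph, indicatorTwo, h]
  · by_cases h : v p <;> simp [repMatrix, borderedMatrix, coneGraph, indicatorTwo, h]
  · by_cases h : (SimpleGraph.pathGraph m).Adj p q <;>
      simp [repMatrix, borderedMatrix, coneGraph, h]

lemma rankCount_coneGraph_sub (m : ℕ) (v : ℕ → Prop) :
    (rankCount (coneGraph m v) m : ℤ) - rankCount (coneGraph m v) (m + 1) =
      ∑ d : Fin m → ZMod 2, ∑ c, corankSign (borderedMatrix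
        (repMatrix (SimpleGraph.pathGraph m) d) (fun p => indicatorTwo v p) c) := by
  have h : ∀ k, (rankCount (coneGraph m v) k : ℤ) =
      ∑ d : Option (Fin m) → ZMod 2, if (repMatrix (coneGraph m v) d).rank = k then 1 else 0 := by
    intro k
    rw [rankCount_eq_card_diagonals, Nat.card_eq_fintype_card, Fintype.card_subtype,
      Finset.card_filter]
    push_cast
    rfl
  rw [h, h, ← Finset.sum_sub_distrib, Finset.sum_comm, ← Fintype.sum_prod_type',
    ← Equiv.sum_comp (Equiv.piOptionEquivProd (β := fun _ : Option (Fin m) => ZMod 2))]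
  refine Finset.sum_congr rfl fun d _ => ?_
  rw [repMatrix_coneGraph]
  simp [corankSign, Equiv.piOptionEquivProd]

section PathKernel

open Matrix

/-- The extension by zero of a function on `Fin m`. -/
def padZero {m : ℕ} (y : Fin m → ZMod 2) (k : ℕ) : ZMod 2 := if h : k < m then y ⟨k, h⟩ else 0

/-- The three-term recurrence solved by the kernel vectors of the path matrix with diagonal `d`:
if this matrix has a kernel, it is spanned by the vector with entries `pathSeq d (p + 1)`. -/
def pathSeq (d : ℕ → ZMod 2) : ℕ → ZMod 2
  | 0 => 0
  | 1 => 1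
  | k + 2 => d k * pathSeq d (k + 1) + pathSeq d k

lemma pathSeq_add_two (d : ℕ → ZMod 2) (k : ℕ) :
    pathSeq d (k + 2) = d k * pathSeq d (k + 1) + pathSeq d k := rfl

lemma pathSeq_congr {d d' : ℕ → ZMod 2} {n : ℕ} (h : ∀ j, j + 1 < n → d j = d' j) :
    ∀ k ≤ n, pathSeq d k = pathSeq d' k
  | 0, _ => rfl
  | 1, _ => rfl
  | k + 2, hk => by
    rw [pathSeq, pathSeq, h k (by omega), pathSeq_congr h (k + 1) (by omega),
      pathSeq_congr h k (by omega)]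

/-- Two consecutive zeros would make the sequence vanish throughout. -/
lemma pathSeq_ne_zero_of_succ (d : ℕ → ZMod 2) :
    ∀ k, pathSeq d (k + 1) = 0 → pathSeq d k ≠ 0
  | 0, h => by simp [pathSeq] at h
  | k + 1, h => by
    intro h'
    rw [pathSeq, h', mul_zero, zero_add] at h
    exact pathSeq_ne_zero_of_succ d k h' h

/-- The extension of `y` by zero to both sides, shifted by one. -/
def padShift {m : ℕ} (y : Fin m → ZMod 2) : ℕ → ZMod 2
  | 0 => 0
  | k + 1 => padZero y k

lemma sum_ite_val_eq {m : ℕ} (y : Fin m → ZMod 2) (a : ℕ) :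
    ∑ j : Fin m, (if (j : ℕ) = a then y j else 0) = padZero y a := by
  unfold padZero
  split_ifs with h
  · rw [Finset.sum_eq_single ⟨a, h⟩]
    · simp
    · intro b _ hb
      rw [if_neg]
      intro hba
      exact hb (Fin.ext hba)
    · simp
  · refine Finset.sum_eq_zero fun j _ => if_neg ?_
    have := j.2
    omega

lemma repMatrix_pathGraph_mulVec {m : ℕ} (d y : Fin m → ZMod 2) (k : Fin m) :
    (repMatrix (SimpleGraph.pathGraph m) d *ᵥ y) k =
      padShift y k + d k * padShift y (k + 1) + padShift y (k + 2) := by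
  have h1 : ∑ j : Fin m, (if (j : ℕ) + 1 = k then y j else 0) = padShift y k := by
    obtain ⟨k, hk⟩ := k
    cases k with
    | zero => simp [padShift]
    | succ k => simpa [padShift] using! sum_ite_val_eq y k
  have h2 : ∑ j : Fin m, (if (j : ℕ) = k then y j else 0) = padShift y (k + 1) :=
    sum_ite_val_eq y k
  have h3 : ∑ j : Fin m, (if (j : ℕ) = k + 1 then y j else 0) = padShift y (k + 2) :=
    sum_ite_val_eq y (k + 1)
  rw [← h1, ← h2, ← h3, Finset.mul_sum, ← Finset.sum_add_distrib, ← Finset.sum_add_distrib]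
  change ∑ j, _ * y j = _
  refine Finset.sum_congr rfl fun j _ => ?_
  simp only [repMatrix, SimpleGraph.pathGraph_adj, Fin.ext_iff]
  split_ifs <;> first | omega | simp

lemma padShift_eq_of_mulVec_eq_zero {m : ℕ} {d y : Fin m → ZMod 2}
    (h : repMatrix (SimpleGraph.pathGraph m) d *ᵥ y = 0) :
    ∀ k ≤ m + 1, padShift y k = padShift y 1 * pathSeq (padZero d) k
  | 0, _ => by simp [padShift, pathSeq]
  | 1, _ => by simp [pathSeq]
  | k + 2, hk => by
    have hk' : k < m := by omega
    have h1 := congrFun h ⟨k, hk'⟩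
    rw [repMatrix_pathGraph_mulVec] at h1
    have h2 : padZero d k = d ⟨k, hk'⟩ := dif_pos hk'
    rw [pathSeq, h2]
    simp only [Pi.zero_apply] at h1
    rw [padShift_eq_of_mulVec_eq_zero h (k + 1) (by omega),
      padShift_eq_of_mulVec_eq_zero h k (by omega)] at h1
    rw [← sub_eq_zero, CharTwo.sub_eq_add]
    linear_combination h1

lemma repMatrix_pathGraph_injective {m : ℕ} {d : Fin m → ZMod 2}
    (hd : pathSeq (padZero d) (m + 1) ≠ 0) (y : Fin m → ZMod 2)
    (h : repMatrix (SimpleGraph.pathGraph m) d *ᵥ y = 0) : y = 0 := by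
  have h1 := padShift_eq_of_mulVec_eq_zero h (m + 1) le_rfl
  have h2 : padShift y (m + 1) = 0 := by simp [padShift, padZero]
  have h3 : padShift y 1 = 0 := by
    rw [h2, eq_comm, mul_eq_zero] at h1
    exact h1.resolve_right hd
  funext p
  have h4 := padShift_eq_of_mulVec_eq_zero h (p + 1) (by omega)
  rw [h3, zero_mul] at h4
  simpa [padShift, padZero] using h4

lemma repMatrix_pathGraph_mulVec_pathSeq {m : ℕ} {d : Fin m → ZMod 2}
    (hd : pathSeq (padZero d) (m + 1) = 0) :
    repMatrix (SimpleGraph.pathGraph m) d *ᵥ (fun p => pathSeq (padZero d) (p + 1)) = 0 := by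
  have h : ∀ k ≤ m + 1, padShift (fun p : Fin m => pathSeq (padZero d) (p + 1)) k =
      pathSeq (padZero d) k := by
    intro k hk
    rcases k with _ | k
    · rfl
    · rcases (by omega : k < m ∨ k = m) with hk' | rfl
      · simp [padShift, padZero, hk']
      · simp [padShift, padZero, hd]
  funext k
  have h2 : padZero d k = d k := by simp [padZero]
  rw [repMatrix_pathGraph_mulVec, h _ (by omega), h _ (by omega), h _ (by omega), pathSeq, h2]
  simp only [Pi.zero_apply]
  linear_combination (d k * pathSeq (padZero d) (k + 1) + pathSeq (padZero d) k) *
    CharTwo.two_eq_zero (R := ZMod 2)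

lemma eq_zero_or_eq_pathSeq_of_mulVec_eq_zero {m : ℕ} {d y : Fin m → ZMod 2}
    (h : repMatrix (SimpleGraph.pathGraph m) d *ᵥ y = 0) :
    y = 0 ∨ y = fun p : Fin m => pathSeq (padZero d) (p + 1) := by
  have h4 : ∀ p : Fin m, y p = padShift y 1 * pathSeq (padZero d) (p + 1) := by
    intro p
    have := padShift_eq_of_mulVec_eq_zero h (p + 1) (by omega)
    rw [← this]
    simp [padShift, padZero]
  rcases zmod_two_eq_zero_or_one (padShift y 1) with h3 | h3
  · left; funext p; rw [h4, h3, zero_mul]; rfl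
  · right; funext p; rw [h4, h3, one_mul]

end PathKernel

/-! ### The signed count of singular path matrices -/

/-- The nontrivial character of the additive group of the field of two elements. -/
def signTwo (x : ZMod 2) : ℤ := if x = 0 then 1 else -1

lemma signTwo_add (x y : ZMod 2) : signTwo (x + y) = signTwo x * signTwo y := by decide +revert

/-- The sum, over the diagonals `d` for which the recurrence `pathSeq` takes the value `e` after
the last vertex of the path on `m` vertices, of the sign `(-1) ^ (w · u)`, where `u` is the vector
defined by the recurrence. For `e = 0` these are the singular path matrices, and `u` spans the
kernel. -/
noncomputable def signedCount (w : ℕ → ZMod 2) (e : ZMod 2) (m : ℕ) : ℤ :=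
  ∑ d : Fin m → ZMod 2, if pathSeq (padZero d) (m + 1) = e then
    signTwo (∑ j ∈ Finset.range m, w j * pathSeq (padZero d) (j + 1)) else 0

lemma signedCount_succ_aux (w : ℕ → ZMod 2) (e : ZMod 2) (m : ℕ) :
    signedCount w e (m + 1) = ∑ d : Fin m → ZMod 2, ∑ x : ZMod 2,
      if x * pathSeq (padZero d) (m + 1) + pathSeq (padZero d) m = e then
        signTwo (∑ j ∈ Finset.range m, w j * pathSeq (padZero d) (j + 1)) *
          signTwo (w m * pathSeq (padZero d) (m + 1)) else 0 := by
  unfold signedCount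
  rw [Finset.sum_comm, ← Fintype.sum_prod_type',
    ← Equiv.sum_comp (Fin.snocEquiv fun _ : Fin (m + 1) => ZMod 2)]
  refine Finset.sum_congr rfl fun p _ => ?_
  obtain ⟨x, d⟩ := p
  have hd : ∀ j < m, padZero (Fin.snoc d x : Fin (m + 1) → ZMod 2) j = padZero d j := by
    intro j hj
    simp [padZero, hj, hj.trans (Nat.lt_succ_self m), Fin.snoc]
  have hx : padZero (Fin.snoc d x : Fin (m + 1) → ZMod 2) m = x := by
    simp [padZero, Fin.snoc]
  have hseq : ∀ k ≤ m + 1, pathSeq (padZero (Fin.snoc d x : Fin (m + 1) → ZMod 2)) k =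
      pathSeq (padZero d) k := pathSeq_congr fun j hj => hd j (by omega)
  have hsum : ∑ j ∈ Finset.range (m + 1),
      w j * pathSeq (padZero (Fin.snoc d x : Fin (m + 1) → ZMod 2)) (j + 1) =
      ∑ j ∈ Finset.range (m + 1), w j * pathSeq (padZero d) (j + 1) := by
    refine Finset.sum_congr rfl fun j hj => ?_
    rw [hseq _ (by simpa using hj)]
  have hlast : pathSeq (padZero (Fin.snoc d x : Fin (m + 1) → ZMod 2)) (m + 1 + 1) =
      x * pathSeq (padZero d) (m + 1) + pathSeq (padZero d) m := by
    rw [pathSeq_add_two, hx, hseq _ le_rfl, hseq _ (by omega)]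
  change (if pathSeq (padZero (Fin.snoc d x : Fin (m + 1) → ZMod 2)) (m + 1 + 1) = e then
    signTwo (∑ j ∈ Finset.range (m + 1),
      w j * pathSeq (padZero (Fin.snoc d x : Fin (m + 1) → ZMod 2)) (j + 1)) else 0) = _
  rw [hsum, Finset.sum_range_succ, signTwo_add]
  simp only [hlast]

lemma signedCount_zero_succ (w : ℕ → ZMod 2) (m : ℕ) :
    signedCount w 0 (m + 1) = signTwo (w m) * signedCount w 1 m := by
  rw [signedCount_succ_aux, signedCount, Finset.mul_sum]
  refine Finset.sum_congr rfl fun d _ => ?_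
  have h := pathSeq_ne_zero_of_succ (padZero d) m
  generalize pathSeq (padZero d) (m + 1) = a at *
  generalize pathSeq (padZero d) m = b at *
  generalize signTwo (∑ j ∈ Finset.range m, w j * pathSeq (padZero d) (j + 1)) = c
  rw [sum_zmod_two _ 0]
  rcases zmod_two_eq_zero_or_one a with rfl | rfl <;>
    rcases zmod_two_eq_zero_or_one b with rfl | rfl <;> simp [mul_comm] at h ⊢
  intro h
  exact absurd (by decide) h

lemma signedCount_one_succ (w : ℕ → ZMod 2) (m : ℕ) :
    signedCount w 1 (m + 1) = signedCount w 0 (m + 1) + 2 * signedCount w 0 m := by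
  rw [signedCount_succ_aux, signedCount_succ_aux, signedCount, Finset.mul_sum,
    ← Finset.sum_add_distrib]
  refine Finset.sum_congr rfl fun d _ => ?_
  have h := pathSeq_ne_zero_of_succ (padZero d) m
  generalize pathSeq (padZero d) (m + 1) = a at *
  generalize pathSeq (padZero d) m = b at *
  generalize signTwo (∑ j ∈ Finset.range m, w j * pathSeq (padZero d) (j + 1)) = c
  rw [sum_zmod_two _ 0, sum_zmod_two _ 0]
  rcases zmod_two_eq_zero_or_one a with rfl | rfl <;>
    rcases zmod_two_eq_zero_or_one b with rfl | rfl <;> simp [signTwo] at h ⊢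
  · ring
  · intro h
    exact absurd (by decide) h

lemma signedCount_zero_zero (w : ℕ → ZMod 2) : signedCount w 0 0 = 0 := by
  simp [signedCount, pathSeq]

lemma signedCount_zero_one (w : ℕ → ZMod 2) : signedCount w 0 1 = signTwo (w 0) := by
  rw [signedCount_zero_succ]
  simp [signedCount, pathSeq, signTwo]

lemma signedCount_zero_add_two (w : ℕ → ZMod 2) (m : ℕ) :
    signedCount w 0 (m + 2) =
      signTwo (w (m + 1)) * (signedCount w 0 (m + 1) + 2 * signedCount w 0 m) := by
  rw [signedCount_zero_succ, signedCount_one_succ]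

open Matrix in
/-- The excess of corank one over corank zero among the matrices representing a cone over a path,
in terms of the singular path matrices: a singular path matrix contributes `1` or `-2` according to
the sign `(-1) ^ (w · u)`, that is, half of three times this sign minus one. -/
lemma two_mul_rankCount_sub (m : ℕ) (v : ℕ → Prop) :
    2 * ((rankCount (coneGraph m v) m : ℤ) - rankCount (coneGraph m v) (m + 1)) =
      3 * signedCount (indicatorTwo v) 0 m - signedCount 0 0 m := by
  rw [rankCount_coneGraph_sub, signedCount, signedCount, Finset.mul_sum, Finset.mul_sum,
    ← Finset.sum_sub_distrib]
  refine Finset.sum_congr rfl fun d _ => ?_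
  by_cases hd : pathSeq (padZero d) (m + 1) = 0
  · have hm : 0 < m := by
      rcases m with _ | m
      · simp [pathSeq] at hd
      · omega
    have hu0 : (fun p : Fin m => pathSeq (padZero d) (p + 1)) ≠ 0 := by
      intro h
      simpa [pathSeq] using congrFun h ⟨0, hm⟩
    have hsymm := (represents_repMatrix (SimpleGraph.pathGraph m) d).1
    have hu := repMatrix_pathGraph_mulVec_pathSeq hd
    have hdot : (fun p : Fin m => indicatorTwo v p) ⬝ᵥ
        (fun p : Fin m => pathSeq (padZero d) (p + 1)) =
        ∑ j ∈ Finset.range m, indicatorTwo v j * pathSeq (padZero d) (j + 1) := by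
      rw [Finset.sum_range]; rfl
    have hker := fun (y : Fin m → ZMod 2) => eq_zero_or_eq_pathSeq_of_mulVec_eq_zero (d := d) (y := y)
    rw [if_pos hd, if_pos hd, ← hdot]
    by_cases hv : (fun p : Fin m => indicatorTwo v p) ⬝ᵥ
        (fun p : Fin m => pathSeq (padZero d) (p + 1)) = 0
    · rw [sum_corankSign_of_dotProduct_eq hsymm hu0 hu hker hv, hv]
      simp [signTwo]
    · rw [sum_corankSign_of_dotProduct_ne hsymm hu hker hv]
      simp [signTwo, hv]
  · rw [sum_corankSign_of_injective (repMatrix_pathGraph_injective hd)]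
    simp [hd]

/-! ### The transfer recurrence along a sign sequence -/

/-- The state after `n` steps of the recurrence `f (k + 1) = σ k * (f k + 2 * f (k - 1))`, where a
state consists of the last two values. -/
def transfer (σ : ℕ → ℤ) : ℕ → ℤ × ℤ → ℤ × ℤ
  | 0, p => p
  | n + 1, p => (σ n * ((transfer σ n p).1 + 2 * (transfer σ n p).2), (transfer σ n p).1)

lemma transfer_add (σ : ℕ → ℤ) (i n : ℕ) (p : ℤ × ℤ) :
    transfer σ (i + n) p = transfer (fun k => σ (i + k)) n (transfer σ i p) := by
  induction n with
  | zero => rfl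
  | succ n ih => rw [← add_assoc, transfer, transfer, ih]

lemma transfer_eq_smul_add_smul (σ : ℕ → ℤ) (n : ℕ) (p : ℤ × ℤ) :
    transfer σ n p = p.1 • transfer σ n (1, 0) + p.2 • transfer σ n (0, 1) := by
  induction n with
  | zero => ext <;> simp [transfer]
  | succ n ih =>
    rw [transfer, transfer, transfer, ih]
    ext
    · simp; ring
    · simp

/-- On a stretch of positive signs `x + y` doubles and `x - 2 y` changes its sign at each step. -/
lemma transfer_of_pos {σ : ℕ → ℤ} {n : ℕ} (h : ∀ k < n, σ k = 1) (p : ℤ × ℤ) :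
    (transfer σ n p).1 + (transfer σ n p).2 = 2 ^ n * (p.1 + p.2) ∧
      (transfer σ n p).1 - 2 * (transfer σ n p).2 = (-1) ^ n * (p.1 - 2 * p.2) := by
  induction n with
  | zero => simp [transfer]
  | succ n ih =>
    obtain ⟨h1, h2⟩ := ih fun k hk => h k (by omega)
    rw [transfer, h n (by omega), pow_succ, pow_succ]
    constructor
    · linear_combination 2 * h1
    · linear_combination -h2

lemma three_mul_transfer_succ {σ : ℕ → ℤ} {n : ℕ} (h : ∀ k < n, σ k = 1) (p : ℤ × ℤ) :
    3 * (transfer σ (n + 1) p).1 =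
      σ n * (2 ^ (n + 2) * (p.1 + p.2) + (-1) ^ (n + 1) * (p.1 - 2 * p.2)) := by
  obtain ⟨h1, h2⟩ := transfer_of_pos h p
  rw [transfer, pow_succ, pow_succ, pow_succ]
  linear_combination σ n * (4 * h1 - h2)

/-- All signs positive is the extremal case. -/
lemma three_mul_abs_transfer_le {σ : ℕ → ℤ} (hσ : ∀ k, |σ k| = 1) (n : ℕ) {p : ℤ × ℤ} {X Y : ℤ}
    (hX : |p.1| ≤ X) (hY : |p.2| ≤ Y) :
    3 * |(transfer σ n p).1| ≤ 2 ^ (n + 1) * (X + Y) + (-1) ^ n * (X - 2 * Y) := by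
  have key : ∀ n, |(transfer σ n p).1| ≤ (transfer (fun _ => 1) n (X, Y)).1 ∧
      |(transfer σ n p).2| ≤ (transfer (fun _ => 1) n (X, Y)).2 := by
    intro n
    induction n with
    | zero => exact ⟨hX, hY⟩
    | succ n ih =>
      refine ⟨?_, ih.1⟩
      rw [transfer, transfer, abs_mul, hσ, one_mul, one_mul]
      refine (abs_add_le _ _).trans ?_
      rw [abs_mul, abs_two]
      linarith [ih.1, ih.2]
  obtain ⟨h1, h2⟩ := transfer_of_pos (σ := fun _ => 1) (n := n) (fun _ _ => rfl) (X, Y)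
  rw [pow_succ]
  simp only at h1 h2
  linarith [(key n).1]

/-- The states after the first negative sign, at `i`, and after the two following steps. The number
`A` is the value that a positive sign at `i` would have given. After three steps the value is
`2 * A` up to one and up to sign, for any choice of the two following signs. -/
lemma transfer_first_neg {σ : ℕ → ℤ} {i : ℕ} (h : ∀ k < i, σ k = 1) (hi : σ i = -1) :
    ∃ A : ℤ, 3 * A = 4 * 2 ^ i - (-1) ^ i ∧ (transfer σ (i + 1) (1, 0)).1 = -A ∧
      2 * (transfer σ (i + 1) (1, 0)).2 = A + (-1) ^ i ∧
      transfer σ (i + 2) (1, 0) = (σ (i + 1) * (-1) ^ i, -A) ∧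
      transfer σ (i + 3) (1, 0) =
        (σ (i + 2) * (σ (i + 1) * (-1) ^ i - 2 * A), σ (i + 1) * (-1) ^ i) := by
  obtain ⟨h1, h2⟩ := transfer_of_pos h (1, 0)
  have h3 : (transfer σ (i + 1) (1, 0)).1 =
      -((transfer σ i (1, 0)).1 + 2 * (transfer σ i (1, 0)).2) := by
    rw [transfer, hi, neg_one_mul]
  have h4 : (transfer σ (i + 1) (1, 0)).2 = (transfer σ i (1, 0)).1 := rfl
  have h5 : transfer σ (i + 2) (1, 0) = (σ (i + 1) * (-1) ^ i,
      -((transfer σ i (1, 0)).1 + 2 * (transfer σ i (1, 0)).2)) := by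
    rw [transfer, h4, h3]
    ext
    · simp only at h2 ⊢; linear_combination σ (i + 1) * h2
    · rfl
  refine ⟨(transfer σ i (1, 0)).1 + 2 * (transfer σ i (1, 0)).2, ?_, h3, ?_, h5, ?_⟩
  · simp only at h1 h2; linear_combination 4 * h1 - h2
  · rw [h4]; simp only at h2; linear_combination h2
  · rw [transfer, h5]; ext
    · simp only; ring
    · rfl

lemma exists_first_neg {σ : ℕ → ℤ} (hσ : ∀ k, |σ k| = 1) {n : ℕ} (h : ∃ k, k < n ∧ σ k = -1) :
    ∃ i < n, (∀ k < i, σ k = 1) ∧ σ i = -1 := by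
  classical
  have h' : ∃ k, σ k = -1 := h.imp fun _ => And.right
  obtain ⟨k, hk, hk'⟩ := h
  refine ⟨Nat.find h', (Nat.find_min' h' hk').trans_lt hk, fun j hj => ?_, Nat.find_spec h'⟩
  have := Nat.find_min h' hj
  rcases eq_or_eq_neg_of_abs_eq (hσ j) with h1 | h1
  · exact h1
  · exact absurd h1 this

lemma one_le_two_pow_int (n : ℕ) : (1 : ℤ) ≤ 2 ^ n := one_le_pow₀ (by norm_num)

/-- The bound for a sequence with at least one negative sign before its last term: asymptotically
half of the extremal value `(2 ^ (n + 1) + (-1) ^ n) / 3`. -/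
lemma three_mul_abs_transfer_le_of_neg {σ : ℕ → ℤ} (hσ : ∀ k, |σ k| = 1) {n : ℕ}
    (h : ∃ k, k < n - 1 ∧ σ k = -1) : 3 * |(transfer σ n (1, 0)).1| ≤ 2 ^ n + 5 := by
  obtain ⟨i, hin, hpos, hi⟩ := exists_first_neg hσ h
  obtain ⟨A, hA, -, -, h2, h3⟩ := transfer_first_neg hpos hi
  have he := neg_one_pow_eq_or ℤ i
  have hα := eq_or_eq_neg_of_abs_eq (hσ (i + 1))
  have hI := one_le_two_pow_int i
  have hA1 : 1 ≤ A := by rcases he with he | he <;> rw [he] at hA <;> omega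
  clear h
  rcases (by omega : n = i + 2 ∨ i + 3 ≤ n) with rfl | hn
  · have : |(transfer σ (i + 2) (1, 0)).1| = 1 := by
      rw [h2]
      simp [abs_mul, hσ]
    rw [this]
    linarith [one_le_two_pow_int (i + 2)]
  · obtain ⟨r, rfl⟩ := Nat.exists_eq_add_of_le hn
    have hX : |(transfer σ (i + 3) (1, 0)).1| ≤ 2 * A + 1 := by
      rw [h3]
      simp only [abs_mul, hσ, one_mul]
      refine abs_le.2 ?_
      rcases he with he | he <;> rcases hα with hα | hα <;> rw [he, hα] <;>
        constructor <;> linarith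
    have hY : |(transfer σ (i + 3) (1, 0)).2| ≤ 1 := by
      rw [h3]
      simp [abs_mul, hσ]
    rw [transfer_add]
    have hb := three_mul_abs_transfer_le (fun k => hσ (i + 3 + k)) r hX hY
    have hR := one_le_two_pow_int r
    have h2I : (-1 : ℤ) ^ i = -1 → (2 : ℤ) ≤ 2 ^ i := by
      rcases i with _ | i
      · simp
      · intro _
        rw [pow_succ]
        linarith [one_le_two_pow_int i]
    rw [pow_add, pow_add]
    rw [pow_succ] at hb
    generalize (2 : ℤ) ^ i = I at *
    generalize (2 : ℤ) ^ r = R at *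
    generalize (-1 : ℤ) ^ i = e at *
    have hAR : 3 * (A * R) = 4 * (I * R) - e * R := by linear_combination R * hA
    rcases neg_one_pow_eq_or ℤ r with hr | hr <;> rw [hr] at hb <;> rcases he with rfl | rfl
    · nlinarith [mul_nonneg (sub_nonneg.2 hI) (sub_nonneg.2 hR)]
    · nlinarith [mul_nonneg (sub_nonneg.2 (h2I rfl)) (sub_nonneg.2 hR)]
    · nlinarith [mul_nonneg (sub_nonneg.2 hI) (sub_nonneg.2 hR)]
    · nlinarith [mul_nonneg (sub_nonneg.2 (h2I rfl)) (sub_nonneg.2 hR)]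


/-- The short sequences that the general estimate of `nine_mul_abs_transfer_le` does not cover. There
are finitely many; their signs are encoded by Booleans, `true` for a negative sign. -/
lemma transfer_short {σ : ℕ → ℤ} (hσ : ∀ k, |σ k| = 1) {i r : ℕ} (hpos : ∀ k < i, σ k = 1)
    (hi : σ i = -1) (hir : i = 0 ∧ (r = 3 ∨ r = 4 ∨ r = 5) ∨ i = 1 ∧ (r = 3 ∨ r = 4))
    (h : ∃ k, k < r - 1 ∧ σ (i + 3 + k) = -1) :
    9 * |(transfer σ (i + 3 + r) (1, 0)).1| ≤ 2 ^ (i + 3 + r + 1) - 1 := by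
  have hb : ∀ k, ∃ b : Bool, σ k = bif b then -1 else 1 := by
    intro k
    rcases eq_or_eq_neg_of_abs_eq (hσ k) with h | h
    · exact ⟨false, h⟩
    · exact ⟨true, h⟩
  choose b hb using hb
  have hneg : ∀ k, σ k = -1 → b k = true := by
    intro k hk
    rw [hb] at hk
    cases hbk : b k
    · rw [hbk] at hk; simp at hk
    · rfl
  have hb0 : ∀ k, σ k = 1 → b k = false := by
    intro k hk
    rw [hb] at hk
    cases hbk : b k
    · rfl
    · rw [hbk] at hk; simp at hk
  obtain ⟨k, hk, hk'⟩ := h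
  replace hk' := hneg _ hk'
  replace hi := hneg _ hi
  rw [← abs_of_pos (show (0 : ℤ) < 9 by norm_num), ← abs_mul, abs_le]
  rcases hir with ⟨rfl, rfl | rfl | rfl⟩ | ⟨rfl, rfl | rfl⟩
  · simp only [transfer, hb, hi, Nat.reduceAdd, Nat.zero_add] at *
    have : b 3 = true ∨ b 4 = true := by
      interval_cases k <;> simp_all
    clear * - this
    generalize b 1 = b1, b 2 = b2, b 3 = b3, b 4 = b4, b 5 = b5 at *
    revert b1 b2 b3 b4 b5
    decide
  · simp only [transfer, hb, hi, Nat.reduceAdd, Nat.zero_add] at *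
    have : b 3 = true ∨ b 4 = true ∨ b 5 = true := by
      interval_cases k <;> simp_all
    clear * - this
    generalize b 1 = b1, b 2 = b2, b 3 = b3, b 4 = b4, b 5 = b5, b 6 = b6 at *
    revert b1 b2 b3 b4 b5 b6
    decide
  · simp only [transfer, hb, hi, Nat.reduceAdd, Nat.zero_add] at *
    have : b 3 = true ∨ b 4 = true ∨ b 5 = true ∨ b 6 = true := by
      interval_cases k <;> simp_all
    clear * - this
    generalize b 1 = b1, b 2 = b2, b 3 = b3, b 4 = b4, b 5 = b5, b 6 = b6, b 7 = b7 at *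
    revert b1 b2 b3 b4 b5 b6 b7
    decide
  · have h0 := hb0 0 (hpos 0 one_pos)
    simp only [transfer, hb, hi, h0, Nat.reduceAdd] at *
    have : b 4 = true ∨ b 5 = true := by
      interval_cases k <;> simp_all
    clear * - this
    generalize b 2 = b2, b 3 = b3, b 4 = b4, b 5 = b5, b 6 = b6 at *
    revert b2 b3 b4 b5 b6
    decide
  · have h0 := hb0 0 (hpos 0 one_pos)
    simp only [transfer, hb, hi, h0, Nat.reduceAdd] at *
    have : b 4 = true ∨ b 5 = true ∨ b 6 = true := by
      interval_cases k <;> simp_all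
    clear * - this
    generalize b 2 = b2, b 3 = b3, b 4 = b4, b 5 = b5, b 6 = b6, b 7 = b7 at *
    revert b2 b3 b4 b5 b6 b7
    decide

lemma two_pow_int_le {m n : ℕ} (h : m ≤ n) : (2 : ℤ) ^ m ≤ 2 ^ n :=
  pow_le_pow_right₀ (by norm_num) h

/-- If, apart from the last sign, there is a negative sign at a distance of at least three from the
first one, the value is at most a third of the extremal one. -/
lemma nine_mul_abs_transfer_le {σ : ℕ → ℤ} (hσ : ∀ k, |σ k| = 1) {i r : ℕ}
    (hpos : ∀ k < i, σ k = 1) (hi : σ i = -1) (h : ∃ k, k < r - 1 ∧ σ (i + 3 + k) = -1) :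
    9 * |(transfer σ (i + 3 + r) (1, 0)).1| ≤ 2 ^ (i + 3 + r + 1) - 1 := by
  by_cases hir : i = 0 ∧ (r = 3 ∨ r = 4 ∨ r = 5) ∨ i = 1 ∧ (r = 3 ∨ r = 4)
  · exact transfer_short hσ hpos hi hir h
  obtain ⟨A, hA, -, -, -, h3⟩ := transfer_first_neg hpos hi
  have he := neg_one_pow_eq_or ℤ i
  have hα := eq_or_eq_neg_of_abs_eq (hσ (i + 1))
  have hI := one_le_two_pow_int i
  have hA1 : 1 ≤ A := by rcases he with he | he <;> rw [he] at hA <;> omega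
  have hX : |(transfer σ (i + 3) (1, 0)).1| ≤ 2 * A + 1 := by
    rw [h3]
    simp only [abs_mul, hσ, one_mul]
    refine abs_le.2 ?_
    rcases he with he | he <;> rcases hα with hα | hα <;> rw [he, hα] <;>
      constructor <;> linarith
  have hY : |(transfer σ (i + 3) (1, 0)).2| ≤ 1 := by
    rw [h3]
    simp [abs_mul, hσ]
  have hr2 : 2 ≤ r := by
    obtain ⟨k, hk, -⟩ := h
    omega
  have h2I : (-1 : ℤ) ^ i = -1 → (2 : ℤ) ≤ 2 ^ i := by
    rcases i with _ | i
    · simp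
    · intro _
      rw [pow_succ]
      linarith [one_le_two_pow_int i]
  rw [transfer_add, show i + 3 + r + 1 = 4 + i + r by ring, pow_add, pow_add]
  rcases hr2.eq_or_lt with rfl | hr3
  · -- The only possible negative sign is the first one of the remaining two.
    have h0 : σ (i + 3) = -1 := by
      obtain ⟨k, hk, hk'⟩ := h
      obtain rfl : k = 0 := by omega
      exact hk'
    have hv : |(transfer (fun k => σ (i + 3 + k)) 2 (transfer σ (i + 3) (1, 0))).1| ≤
        2 * A + 1 + 2 * 1 := by
      refine le_trans (le_of_eq ?_) ((abs_sub _ _).trans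
        (add_le_add hX ((abs_mul _ _).trans_le (mul_le_mul_of_nonneg_left hY (abs_nonneg 2)))))
      simp only [transfer, add_zero, h0, abs_mul, hσ, one_mul]
      congr 1
      ring
    rcases he with he | he <;> rw [he] at hA
    · linarith
    · linarith [h2I he]
  · have hb1 := three_mul_abs_transfer_le_of_neg (fun k => hσ (i + 3 + k)) h
    have hb2 := three_mul_abs_transfer_le (fun k => hσ (i + 3 + k)) r (p := (0, 1))
      (X := 0) (Y := 1) (by simp) (by simp)
    have hb : |(transfer (fun k => σ (i + 3 + k)) r (transfer σ (i + 3) (1, 0))).1| ≤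
        (2 * A + 1) * |(transfer (fun k => σ (i + 3 + k)) r (1, 0)).1| +
          |(transfer (fun k => σ (i + 3 + k)) r (0, 1)).1| := by
      rw [transfer_eq_smul_add_smul]
      refine (abs_add_le _ _).trans (add_le_add ?_ ?_)
      · simp only [Prod.smul_fst, smul_eq_mul, abs_mul]
        exact mul_le_mul_of_nonneg_right hX (abs_nonneg _)
      · simp only [Prod.smul_fst, smul_eq_mul, abs_mul]
        exact mul_le_of_le_one_left (abs_nonneg _) hY
    have hb3 : 9 * |(transfer (fun k => σ (i + 3 + k)) r (transfer σ (i + 3) (1, 0))).1| ≤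
        3 * ((2 * A + 1) * (2 ^ r + 5)) + 3 * (2 * 2 ^ r + 2) := by
      have h5 := mul_le_mul_of_nonneg_left hb1 (show 0 ≤ 2 * A + 1 by linarith)
      rw [pow_succ] at hb2
      rcases neg_one_pow_eq_or ℤ r with hr | hr <;> rw [hr] at hb2 <;> linarith
    refine hb3.trans ?_
    have hR8 : (8 : ℤ) ≤ 2 ^ r := two_pow_int_le (m := 3) hr3
    have hAR : 3 * (A * 2 ^ r) = 4 * (2 ^ i * 2 ^ r) - (-1) ^ i * 2 ^ r := by
      linear_combination 2 ^ r * hA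
    rcases (by omega : i = 0 ∨ i = 1 ∨ 2 ≤ i) with rfl | rfl | hi2
    · have hR : (64 : ℤ) ≤ 2 ^ r := two_pow_int_le (m := 6) (by omega)
      norm_num at hA hAR ⊢
      linarith
    · have hR : (32 : ℤ) ≤ 2 ^ r := two_pow_int_le (m := 5) (by omega)
      norm_num at hA hAR ⊢
      linarith
    · have hI4 : (4 : ℤ) ≤ 2 ^ i := two_pow_int_le (m := 2) hi2
      have hI8 : (-1 : ℤ) ^ i = -1 → (8 : ℤ) ≤ 2 ^ i := by
        intro h1
        rcases (by omega : i = 2 ∨ 3 ≤ i) with rfl | h3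
        · norm_num at h1
        · exact two_pow_int_le (m := 3) h3
      generalize (2 : ℤ) ^ i = I at *
      generalize (2 : ℤ) ^ r = R at *
      rcases he with he | he <;> rw [he] at hA hAR
      · nlinarith [mul_nonneg (sub_nonneg.2 hI4) (sub_nonneg.2 hR8)]
      · have hI8' := hI8 he
        nlinarith [mul_nonneg (sub_nonneg.2 hI8') (sub_nonneg.2 hR8)]

/-! ### The sequences with few negative signs -/

/-- The quantity `f m`, for `m = r + 1`, of the recurrence `f 0 = 0`, `f 1 = σ 0`,
`f (k + 2) = σ (k + 1) * (f (k + 1) + 2 * f k)`. -/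
def signedValue (σ : ℕ → ℤ) (r : ℕ) : ℤ := σ 0 * (transfer (fun k => σ (k + 1)) r (1, 0)).1

lemma min_even_dichotomy_of_le {s t : ℕ} (hs : 1 ≤ s) (hst : s ≤ t) :
    (Even s ∧ 4 ≤ (-1) ^ t * 2 ^ s + (-1) ^ s * 2 ^ t) ∨
      (¬ Even s ∧ (-1 : ℤ) ^ t * 2 ^ s + (-1) ^ s * 2 ^ t ≤ -2 ∧
        ((-1 : ℤ) ^ (s + t) = 1 → (-1 : ℤ) ^ t * 2 ^ s + (-1) ^ s * 2 ^ t ≤ -4)) := by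
  have hX : (2 : ℤ) ≤ 2 ^ s := two_pow_int_le (m := 1) hs
  rcases hst.eq_or_lt with rfl | hlt
  · rcases Nat.even_or_odd s with h | h
    · left; refine ⟨h, ?_⟩; rw [h.neg_one_pow]; linarith
    · right; refine ⟨Nat.not_even_iff_odd.2 h, ?_, fun _ => ?_⟩ <;> rw [h.neg_one_pow] <;> linarith
  · have hXY : (2 : ℤ) * 2 ^ s ≤ 2 ^ t := by
      rw [← pow_succ']
      exact two_pow_int_le hlt
    rcases Nat.even_or_odd s with h | h
    · left
      have hX4 : (4 : ℤ) ≤ 2 ^ s := by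
        obtain ⟨a, rfl⟩ := h
        exact two_pow_int_le (m := 2) (by omega)
      refine ⟨h, ?_⟩
      rw [h.neg_one_pow]
      rcases neg_one_pow_eq_or ℤ t with ht | ht <;> rw [ht] <;> linarith
    · right
      rw [pow_add, h.neg_one_pow]
      refine ⟨Nat.not_even_iff_odd.2 h, ?_, ?_⟩
      · rcases neg_one_pow_eq_or ℤ t with ht | ht <;> rw [ht] <;> linarith
      · rcases neg_one_pow_eq_or ℤ t with ht | ht <;> rw [ht]
        · norm_num
        · intro _; linarith

/-- The parity of the smaller of `s` and `t` decides the sign of the oscillating correction term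
to the asymptotic value of the sequences with few negative signs. -/
lemma min_even_dichotomy {s t : ℕ} (hs : 1 ≤ s) (ht : 1 ≤ t) :
    (Even (min s t) ∧ 4 ≤ (-1) ^ t * 2 ^ s + (-1) ^ s * 2 ^ t) ∨
      (¬ Even (min s t) ∧ (-1 : ℤ) ^ t * 2 ^ s + (-1) ^ s * 2 ^ t ≤ -2 ∧
        ((-1 : ℤ) ^ (s + t) = 1 → (-1 : ℤ) ^ t * 2 ^ s + (-1) ^ s * 2 ^ t ≤ -4)) := by
  rcases le_total s t with h | h
  · rw [min_eq_left h]; exact min_even_dichotomy_of_le hs h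
  · rw [min_eq_right h, add_comm s t, add_comm ((-1 : ℤ) ^ t * _)]
    exact min_even_dichotomy_of_le ht h

lemma abs_correction_le {s t : ℕ} (hs : 1 ≤ s) (ht : 1 ≤ t) :
    |(-1 : ℤ) ^ t * 2 ^ s + (-1) ^ s * 2 ^ t| ≤ 2 ^ s * 2 ^ t := by
  have hX : (2 : ℤ) ≤ 2 ^ s := two_pow_int_le (m := 1) hs
  have hY : (2 : ℤ) ≤ 2 ^ t := two_pow_int_le (m := 1) ht
  refine (abs_add_le _ _).trans ?_
  rw [abs_mul, abs_mul, abs_neg_one_pow, abs_neg_one_pow, abs_of_pos (by positivity),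
    abs_of_pos (by positivity)]
  nlinarith

lemma four_le_two_pow_mul {s t : ℕ} (hs : 1 ≤ s) (ht : 1 ≤ t) : (4 : ℤ) ≤ 2 ^ s * 2 ^ t := by
  rw [← pow_add]
  exact two_pow_int_le (m := 2) (by omega)

section

variable {σ : ℕ → ℤ}

lemma mul_eq_one_or (hσ : ∀ k, |σ k| = 1) (r : ℕ) : σ 0 * σ r = 1 ∨ σ 0 * σ r = -1 :=
  eq_or_eq_neg_of_abs_eq (by rw [abs_mul, hσ, hσ, one_mul])

/-- The signs strictly between the positions `0` and `r` are `-1` on `C` and `1` elsewhere. -/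
def InteriorNeg (σ : ℕ → ℤ) (r : ℕ) (C : ℕ → Prop) : Prop :=
  ∀ k, 1 ≤ k → k < r → ((C k → σ k = -1) ∧ (¬ C k → σ k = 1))

lemma signedValue_interior_none {r : ℕ} (hr : 1 ≤ r) (h : InteriorNeg σ r fun _ => False) :
    3 * signedValue σ r = σ 0 * σ r * (2 ^ (r + 1) + (-1) ^ r) := by
  obtain ⟨n, rfl⟩ := Nat.exists_eq_add_of_le' hr
  have := three_mul_transfer_succ (σ := fun k => σ (k + 1)) (n := n)
    (fun k hk => (h (k + 1) (by omega) (by omega)).2 id) (1, 0)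
  rw [signedValue]
  simp only at this
  linear_combination σ 0 * this

lemma signedValue_interior_single {s t : ℕ} (hs : 1 ≤ s) (ht : 1 ≤ t)
    (h : InteriorNeg σ (s + t) fun k => k = s) :
    9 * signedValue σ (s + t) = σ 0 * σ (s + t) * (-2 * (2 ^ s * 2 ^ t)
      - 4 * ((-1) ^ t * 2 ^ s + (-1) ^ s * 2 ^ t) + (-1) ^ (s + t)) := by
  obtain ⟨i, rfl⟩ := Nat.exists_eq_add_of_le' hs
  obtain ⟨n, rfl⟩ := Nat.exists_eq_add_of_le' ht
  obtain ⟨A, hA, h1, h2, -, -⟩ := transfer_first_neg (σ := fun k => σ (k + 1)) (i := i)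
    (fun k hk => (h (k + 1) (by omega) (by omega)).2 (by omega))
    ((h (i + 1) (by omega) (by omega)).1 rfl)
  have h3 := three_mul_transfer_succ (σ := fun k => σ (i + 1 + k + 1)) (n := n)
    (fun k hk => (h _ (by omega) (by omega)).2 (by omega))
    (transfer (fun k => σ (k + 1)) (i + 1) (1, 0))
  rw [signedValue, transfer_add]
  rw [h1] at h3
  have h4 : σ (i + 1 + n + 1) = σ (i + 1 + (n + 1)) := by rw [add_assoc (i + 1)]
  rw [h4] at h3
  refine mul_left_cancel₀ (two_ne_zero (α := ℤ)) ?_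
  simp only [pow_add, pow_one, pow_two] at h3 ⊢
  linear_combination 6 * σ 0 * h3 + σ 0 * σ (i + 1 + (n + 1)) *
    ((3 * 4 * 2 ^ n + 6 * (-1) ^ n) * h2 + (-4 * 2 ^ n + 4 * (-1) ^ n) * hA)

lemma signedValue_interior_double {s t : ℕ} (hs : 1 ≤ s) (ht : 1 ≤ t)
    (h : InteriorNeg σ (s + 1 + t) fun k => k = s ∨ k = s + 1) :
    9 * signedValue σ (s + 1 + t) = σ 0 * σ (s + 1 + t) * (-4 * (2 ^ s * 2 ^ t)
      + 4 * ((-1) ^ t * 2 ^ s + (-1) ^ s * 2 ^ t) + 5 * (-1) ^ (s + t)) := by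
  obtain ⟨i, rfl⟩ := Nat.exists_eq_add_of_le' hs
  obtain ⟨n, rfl⟩ := Nat.exists_eq_add_of_le' ht
  obtain ⟨A, hA, -, -, h1, -⟩ := transfer_first_neg (σ := fun k => σ (k + 1)) (i := i)
    (fun k hk => (h (k + 1) (by omega) (by omega)).2 (by omega))
    ((h (i + 1) (by omega) (by omega)).1 (by simp))
  have hα : σ (i + 1 + 1) = -1 := (h _ (by omega) (by omega)).1 (by simp)
  have h3 := three_mul_transfer_succ (σ := fun k => σ (i + 2 + k + 1)) (n := n)
    (fun k hk => (h _ (by omega) (by omega)).2 (by omega))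
    (transfer (fun k => σ (k + 1)) (i + 2) (1, 0))
  rw [signedValue, show i + 1 + 1 = i + 2 from rfl, transfer_add]
  rw [h1, hα] at h3
  have h4 : σ (i + 2 + n + 1) = σ (i + 2 + (n + 1)) := by rw [add_assoc (i + 2)]
  rw [h4] at h3
  rw [h1, hα]
  simp only [pow_add, pow_one, pow_two] at h3 ⊢
  linear_combination 3 * σ 0 * h3 + σ 0 * σ (i + 2 + (n + 1)) *
    (-4 * 2 ^ n - 2 * (-1) ^ n) * hA

lemma signedValue_interior_gap {s t : ℕ} (hs : 1 ≤ s) (ht : 1 ≤ t)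
    (h : InteriorNeg σ (s + 2 + t) fun k => k = s ∨ k = s + 2) :
    9 * signedValue σ (s + 2 + t) = σ 0 * σ (s + 2 + t) * (8 * (2 ^ s * 2 ^ t)
      + 4 * ((-1) ^ t * 2 ^ s + (-1) ^ s * 2 ^ t) + 11 * (-1) ^ (s + t)) := by
  obtain ⟨i, rfl⟩ := Nat.exists_eq_add_of_le' hs
  obtain ⟨n, rfl⟩ := Nat.exists_eq_add_of_le' ht
  obtain ⟨A, hA, -, -, -, h1⟩ := transfer_first_neg (σ := fun k => σ (k + 1)) (i := i)
    (fun k hk => (h (k + 1) (by omega) (by omega)).2 (by omega))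
    ((h (i + 1) (by omega) (by omega)).1 (by simp))
  have hα : σ (i + 1 + 1) = 1 := (h _ (by omega) (by omega)).2 (by omega)
  have hβ : σ (i + 2 + 1) = -1 := (h _ (by omega) (by omega)).1 (by omega)
  have h3 := three_mul_transfer_succ (σ := fun k => σ (i + 3 + k + 1)) (n := n)
    (fun k hk => (h _ (by omega) (by omega)).2 (by omega))
    (transfer (fun k => σ (k + 1)) (i + 3) (1, 0))
  rw [signedValue, show i + 1 + 2 = i + 3 from rfl, transfer_add]
  rw [h1, hα, hβ] at h3
  have h4 : σ (i + 3 + n + 1) = σ (i + 3 + (n + 1)) := by rw [add_assoc (i + 3)]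
  rw [h4] at h3
  rw [h1, hα, hβ]
  simp only [pow_add, pow_one, pow_two] at h3 ⊢
  linear_combination 3 * σ 0 * h3 + σ 0 * σ (i + 3 + (n + 1)) *
    (8 * 2 ^ n - 2 * (-1) ^ n) * hA

lemma signedValue_interior_triple {s t : ℕ} (hs : 1 ≤ s) (ht : 1 ≤ t)
    (h : InteriorNeg σ (s + 2 + t) fun k => k = s ∨ k = s + 1 ∨ k = s + 2) :
    9 * signedValue σ (s + 2 + t) = σ 0 * σ (s + 2 + t) * (8 * (2 ^ s * 2 ^ t)
      + 4 * ((-1) ^ t * 2 ^ s + (-1) ^ s * 2 ^ t) - 7 * (-1) ^ (s + t)) := by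
  obtain ⟨i, rfl⟩ := Nat.exists_eq_add_of_le' hs
  obtain ⟨n, rfl⟩ := Nat.exists_eq_add_of_le' ht
  obtain ⟨A, hA, -, -, -, h1⟩ := transfer_first_neg (σ := fun k => σ (k + 1)) (i := i)
    (fun k hk => (h (k + 1) (by omega) (by omega)).2 (by omega))
    ((h (i + 1) (by omega) (by omega)).1 (by simp))
  have hα : σ (i + 1 + 1) = -1 := (h _ (by omega) (by omega)).1 (by omega)
  have hβ : σ (i + 2 + 1) = -1 := (h _ (by omega) (by omega)).1 (by omega)
  have h3 := three_mul_transfer_succ (σ := fun k => σ (i + 3 + k + 1)) (n := n)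
    (fun k hk => (h _ (by omega) (by omega)).2 (by omega))
    (transfer (fun k => σ (k + 1)) (i + 3) (1, 0))
  rw [signedValue, show i + 1 + 2 = i + 3 from rfl, transfer_add]
  rw [h1, hα, hβ] at h3
  have h4 : σ (i + 3 + n + 1) = σ (i + 3 + (n + 1)) := by rw [add_assoc (i + 3)]
  rw [h4] at h3
  rw [h1, hα, hβ]
  simp only [pow_add, pow_one, pow_two] at h3 ⊢
  linear_combination 3 * σ 0 * h3 + σ 0 * σ (i + 3 + (n + 1)) *
    (8 * 2 ^ n - 2 * (-1) ^ n) * hA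

/-- The value of `σ` exceeds a third of the extremal value `(2 ^ (r + 1) + (-1) ^ r) / 3`. -/
def IsLarge (σ : ℕ → ℤ) (r : ℕ) : Prop := 2 ^ (r + 1) + (-1) ^ r < 9 * signedValue σ r

/-! ### The classification of the large sign sequences -/

lemma isLarge_interior_none (hσ : ∀ k, |σ k| = 1) {r : ℕ} (hr : 1 ≤ r)
    (h : InteriorNeg σ r fun _ => False) : IsLarge σ r ↔ σ 0 * σ r = 1 := by
  have h1 := signedValue_interior_none hr h
  have h2 : (4 : ℤ) ≤ 2 ^ (r + 1) := two_pow_int_le (m := 2) (by omega)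
  unfold IsLarge
  rcases mul_eq_one_or hσ r with h0 | h0 <;> rw [h0] at h1 ⊢ <;>
    rcases neg_one_pow_eq_or ℤ r with he | he <;> rw [he] at h1 ⊢ <;> omega

lemma isLarge_interior_single (hσ : ∀ k, |σ k| = 1) {s t : ℕ} (hs : 1 ≤ s) (ht : 1 ≤ t)
    (h : InteriorNeg σ (s + t) fun k => k = s) :
    IsLarge σ (s + t) ↔ σ 0 * σ (s + t) = -1 ∧ Even (min s t) := by
  have h1 := signedValue_interior_single hs ht h
  have h2 := min_even_dichotomy hs ht
  have h3 := abs_le.1 (abs_correction_le hs ht)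
  have h4 := four_le_two_pow_mul hs ht
  have h5 : (2 : ℤ) ^ (s + t + 1) = 2 * (2 ^ s * 2 ^ t) := by ring
  unfold IsLarge
  rw [h5]
  generalize (-1 : ℤ) ^ t * 2 ^ s + (-1) ^ s * 2 ^ t = K at *
  generalize (2 : ℤ) ^ s * 2 ^ t = Z at *
  rcases mul_eq_one_or hσ (s + t) with h0 | h0 <;> rw [h0] at h1 ⊢ <;>
    rcases neg_one_pow_eq_or ℤ (s + t) with he | he <;> rw [he] at h1 h2 ⊢ <;>
    rcases h2 with ⟨hE, h2⟩ | ⟨hE, h2, h6⟩ <;>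
    simp only [hE, and_true, and_false, iff_true, iff_false] <;> omega

lemma isLarge_interior_double (hσ : ∀ k, |σ k| = 1) {s t : ℕ} (hs : 1 ≤ s) (ht : 1 ≤ t)
    (h : InteriorNeg σ (s + 1 + t) fun k => k = s ∨ k = s + 1) :
    IsLarge σ (s + 1 + t) ↔ σ 0 * σ (s + 1 + t) = -1 ∧ ¬ Even (min s t) := by
  have h1 := signedValue_interior_double hs ht h
  have h2 := min_even_dichotomy hs ht
  have h3 := abs_le.1 (abs_correction_le hs ht)
  have h4 := four_le_two_pow_mul hs ht
  have h5 : (2 : ℤ) ^ (s + 1 + t + 1) = 4 * (2 ^ s * 2 ^ t) := by ring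
  have h6 : (-1 : ℤ) ^ (s + 1 + t) = - (-1) ^ (s + t) := by ring
  unfold IsLarge
  rw [h5, h6]
  generalize (-1 : ℤ) ^ t * 2 ^ s + (-1) ^ s * 2 ^ t = K at *
  generalize (2 : ℤ) ^ s * 2 ^ t = Z at *
  rcases mul_eq_one_or hσ (s + 1 + t) with h0 | h0 <;> rw [h0] at h1 ⊢ <;>
    rcases neg_one_pow_eq_or ℤ (s + t) with he | he <;> rw [he] at h1 h2 ⊢ <;>
    rcases h2 with ⟨hE, h2⟩ | ⟨hE, h2, h6⟩ <;>
    simp only [hE, not_true, not_false_eq_true, and_true, and_false, iff_true, iff_false] <;> omega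

lemma isLarge_interior_gap (hσ : ∀ k, |σ k| = 1) {s t : ℕ} (hs : 1 ≤ s) (ht : 1 ≤ t)
    (h : InteriorNeg σ (s + 2 + t) fun k => k = s ∨ k = s + 2) :
    IsLarge σ (s + 2 + t) ↔ σ 0 * σ (s + 2 + t) = 1 ∧ Even (min s t) := by
  have h1 := signedValue_interior_gap hs ht h
  have h2 := min_even_dichotomy hs ht
  have h3 := abs_le.1 (abs_correction_le hs ht)
  have h4 := four_le_two_pow_mul hs ht
  have h5 : (2 : ℤ) ^ (s + 2 + t + 1) = 8 * (2 ^ s * 2 ^ t) := by ring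
  have h6 : (-1 : ℤ) ^ (s + 2 + t) = (-1) ^ (s + t) := by ring
  unfold IsLarge
  rw [h5, h6]
  generalize (-1 : ℤ) ^ t * 2 ^ s + (-1) ^ s * 2 ^ t = K at *
  generalize (2 : ℤ) ^ s * 2 ^ t = Z at *
  rcases mul_eq_one_or hσ (s + 2 + t) with h0 | h0 <;> rw [h0] at h1 ⊢ <;>
    rcases neg_one_pow_eq_or ℤ (s + t) with he | he <;> rw [he] at h1 h2 ⊢ <;>
    rcases h2 with ⟨hE, h2⟩ | ⟨hE, h2, h6⟩ <;>
    simp only [hE, and_true, and_false, iff_true, iff_false] <;> omega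

lemma isLarge_interior_triple (hσ : ∀ k, |σ k| = 1) {s t : ℕ} (hs : 1 ≤ s) (ht : 1 ≤ t)
    (h : InteriorNeg σ (s + 2 + t) fun k => k = s ∨ k = s + 1 ∨ k = s + 2) :
    IsLarge σ (s + 2 + t) ↔ σ 0 * σ (s + 2 + t) = 1 ∧ Even (min s t) := by
  have h1 := signedValue_interior_triple hs ht h
  have h2 := min_even_dichotomy hs ht
  have h3 := abs_le.1 (abs_correction_le hs ht)
  have h4 := four_le_two_pow_mul hs ht
  have h5 : (2 : ℤ) ^ (s + 2 + t + 1) = 8 * (2 ^ s * 2 ^ t) := by ring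
  have h6 : (-1 : ℤ) ^ (s + 2 + t) = (-1) ^ (s + t) := by ring
  unfold IsLarge
  rw [h5, h6]
  generalize (-1 : ℤ) ^ t * 2 ^ s + (-1) ^ s * 2 ^ t = K at *
  generalize (2 : ℤ) ^ s * 2 ^ t = Z at *
  rcases mul_eq_one_or hσ (s + 2 + t) with h0 | h0 <;> rw [h0] at h1 ⊢ <;>
    rcases neg_one_pow_eq_or ℤ (s + t) with he | he <;> rw [he] at h1 h2 ⊢ <;>
    rcases h2 with ⟨hE, h2⟩ | ⟨hE, h2, h6⟩ <;>
    simp only [hE, and_true, and_false, iff_true, iff_false] <;> omega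

/-- The only sign patterns of large sequences between the two ends. -/
lemma IsLarge.interior_cases (hσ : ∀ k, |σ k| = 1) {r : ℕ} (h : IsLarge σ r) :
    InteriorNeg σ r (fun _ => False) ∨ ∃ s t, 1 ≤ s ∧ 1 ≤ t ∧
      ((r = s + t ∧ InteriorNeg σ r fun k => k = s) ∨
        (r = s + 1 + t ∧ InteriorNeg σ r fun k => k = s ∨ k = s + 1) ∨
        (r = s + 2 + t ∧ InteriorNeg σ r fun k => k = s ∨ k = s + 2) ∨
        (r = s + 2 + t ∧ InteriorNeg σ r fun k => k = s ∨ k = s + 1 ∨ k = s + 2)) := by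
  have hor : ∀ k, σ k = 1 ∨ σ k = -1 := fun k => eq_or_eq_neg_of_abs_eq (hσ k)
  by_cases hneg : ∃ k, k < r - 1 ∧ σ (k + 1) = -1
  swap
  · left
    refine fun k hk hkr => ⟨False.elim, fun _ => (hor k).resolve_right fun hk' => hneg ?_⟩
    exact ⟨k - 1, by omega, by rwa [Nat.sub_add_cancel hk]⟩
  right
  obtain ⟨i, hir, hpos, hi⟩ := exists_first_neg (fun k => hσ (k + 1)) hneg
  have hfar : ∀ k, i + 4 ≤ k → k < r → σ k = 1 := by
    intro k hik hkr
    refine (hor k).resolve_right fun hk => absurd h ?_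
    obtain ⟨n, rfl⟩ := Nat.exists_eq_add_of_le (show i + 3 ≤ r by omega)
    have := nine_mul_abs_transfer_le (fun k => hσ (k + 1)) (r := n) hpos hi
      ⟨k - (i + 4), by omega, by rwa [show i + 3 + (k - (i + 4)) + 1 = k by omega]⟩
    rw [IsLarge, signedValue, not_lt]
    have h1 := le_abs_self (σ 0 * (transfer (fun k => σ (k + 1)) (i + 3 + n) (1, 0)).1)
    rw [abs_mul, hσ, one_mul] at h1
    rcases neg_one_pow_eq_or ℤ (i + 3 + n) with he | he <;> rw [he] <;> linarith
  have hbefore : ∀ k, 1 ≤ k → k ≤ i → σ k = 1 := by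
    intro k hk hki
    have := hpos (k - 1) (by omega)
    rwa [Nat.sub_add_cancel hk] at this
  have key : ∀ C : ℕ → Prop, C (i + 1) → (i + 2 < r → ((C (i + 2) → σ (i + 2) = -1) ∧
      (¬ C (i + 2) → σ (i + 2) = 1))) → (i + 3 < r → ((C (i + 3) → σ (i + 3) = -1) ∧
      (¬ C (i + 3) → σ (i + 3) = 1))) → (∀ k, k ≤ i → ¬ C k) →
      (∀ k, i + 4 ≤ k → ¬ C k) → InteriorNeg σ r C := by
    intro C h1 h2 h3 h4 h5 k hk hkr
    rcases (by omega : k ≤ i ∨ k = i + 1 ∨ k = i + 2 ∨ k = i + 3 ∨ i + 4 ≤ k) with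
      hki | rfl | rfl | rfl | hki
    · exact ⟨fun hC => absurd hC (h4 k hki), fun _ => hbefore k hk hki⟩
    · exact ⟨fun _ => hi, fun hC => absurd h1 hC⟩
    · exact h2 hkr
    · exact h3 hkr
    · exact ⟨fun hC => absurd hC (h5 k hki), fun _ => hfar k hki hkr⟩
  by_cases h2 : i + 2 < r ∧ σ (i + 2) = -1 <;> by_cases h3 : i + 3 < r ∧ σ (i + 3) = -1
  · refine ⟨i + 1, r - (i + 3), by omega, by omega, Or.inr (Or.inr (Or.inr ⟨by omega, ?_⟩))⟩
    exact key _ (by omega) (fun _ => ⟨fun _ => h2.2, by omega⟩) (fun _ => ⟨fun _ => h3.2, by omega⟩)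
      (by omega) (by omega)
  · refine ⟨i + 1, r - (i + 2), by omega, by omega, Or.inr (Or.inl ⟨by omega, ?_⟩)⟩
    exact key _ (by omega) (fun _ => ⟨fun _ => h2.2, by omega⟩)
      (fun hr => ⟨by omega, fun _ => (hor _).resolve_right fun h => h3 ⟨hr, h⟩⟩)
      (by omega) (by omega)
  · refine ⟨i + 1, r - (i + 3), by omega, by omega, Or.inr (Or.inr (Or.inl ⟨by omega, ?_⟩))⟩
    exact key _ (by omega)
      (fun hr => ⟨by omega, fun _ => (hor _).resolve_right fun h => h2 ⟨hr, h⟩⟩)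
      (fun _ => ⟨fun _ => h3.2, by omega⟩) (by omega) (by omega)
  · refine ⟨i + 1, r - (i + 1), by omega, by omega, Or.inl ⟨by omega, ?_⟩⟩
    exact key _ (by omega)
      (fun hr => ⟨by omega, fun _ => (hor _).resolve_right fun h => h2 ⟨hr, h⟩⟩)
      (fun hr => ⟨by omega, fun _ => (hor _).resolve_right fun h => h3 ⟨hr, h⟩⟩)
      (by omega) (by omega)

end

/-! ### Cones over a path and the class of graphs -/

lemma gapGraph_eq_coneGraph (t : List ℕ) :
    gapGraph t = coneGraph (t.sum + 1) (IsNbrPosition t) := by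
  ext (_ | p) (_ | q) <;> rfl

lemma coneGraph_congr {m : ℕ} {v w : ℕ → Prop} (h : ∀ p < m, (v p ↔ w p)) :
    coneGraph m v = coneGraph m w := by
  ext (_ | p) (_ | q)
  · rfl
  · exact h q q.2
  · exact h p p.2
  · rfl

lemma nonempty_coneGraph_iso_reverse (r : ℕ) (v : ℕ → Prop) :
    Nonempty (coneGraph (r + 1) v ≃g coneGraph (r + 1) fun p => v (r - p)) := by
  refine ⟨⟨Fin.revPerm.optionCongr, ?_⟩⟩
  have hr : ∀ p : Fin (r + 1), r - (Fin.rev p : ℕ) = p := by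
    intro p
    rw [Fin.val_rev]
    omega
  rintro (_ | p) (_ | q)
  · rfl
  · change v (r - (Fin.rev q : ℕ)) ↔ v q
    rw [hr]
  · change v (r - (Fin.rev p : ℕ)) ↔ v p
    rw [hr]
  · change (SimpleGraph.pathGraph _).Adj (Fin.rev p) (Fin.rev q) ↔
      (SimpleGraph.pathGraph _).Adj p q
    rw [SimpleGraph.pathGraph_adj, SimpleGraph.pathGraph_adj, Fin.val_rev, Fin.val_rev]
    omega

lemma isGamma_of_iso {V : Type*} {Γ : SimpleGraph V} {r : ℕ} {v : ℕ → Prop}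
    (e : Γ ≃g coneGraph (r + 1) v) {t : List ℕ} (ht : t.sum = r)
    (h : (∀ p ≤ r, (v p ↔ IsNbrPosition t p)) ∨ ∀ p ≤ r, (v (r - p) ↔ IsNbrPosition t p)) :
    IsGamma Γ t := by
  subst ht
  rw [IsGamma, gapGraph_eq_coneGraph]
  rcases h with h | h
  · rw [← coneGraph_congr fun p hp => h p (Nat.lt_succ_iff.1 hp)]
    exact ⟨e⟩
  · rw [← coneGraph_congr fun p hp => h p (Nat.lt_succ_iff.1 hp)]
    exact (nonempty_coneGraph_iso_reverse _ v).map e.trans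

lemma InClassG.exists_iso_coneGraph {V : Type*} {Γ : SimpleGraph V} (h : InClassG Γ) :
    ∃ (r : ℕ) (v : ℕ → Prop), (∃ p ≤ r, v p) ∧ Nonempty (Γ ≃g coneGraph (r + 1) v) := by
  obtain ⟨hconn, x, m, hm, ⟨f⟩⟩ := h
  obtain ⟨r, rfl⟩ := Nat.exists_eq_add_of_le' hm
  let v : ℕ → Prop := fun p => ∃ hp : p < r + 1, Γ.Adj x (f ⟨p, hp⟩)
  have hv : ∀ p : Fin (r + 1), v p ↔ Γ.Adj x (f p) := fun p => ⟨fun h => h.2, fun h => ⟨p.2, h⟩⟩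
  let g : Option (Fin (r + 1)) → V := fun o => o.elim x fun p => f p
  have hg : Function.Bijective g := by
    constructor
    · rintro (_ | p) (_ | q) h
      · rfl
      · exact absurd h.symm (f q).2
      · exact absurd h (f p).2
      · exact congrArg some (f.injective (Subtype.ext h))
    · intro y
      by_cases hy : y = x
      · exact ⟨none, hy.symm⟩
      · exact ⟨some (f.symm ⟨y, hy⟩), by simp [g]⟩
  refine ⟨r, v, ?_, ⟨RelIso.symm ⟨Equiv.ofBijective g hg, ?_⟩⟩⟩
  · have hne : (f 0 : V) ≠ x := (f 0).2
    have : Nontrivial V := ⟨⟨_, _, hne⟩⟩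
    obtain ⟨w, hw⟩ := hconn.preconnected.exists_adj_of_nontrivial x
    obtain ⟨_ | p, rfl⟩ := hg.2 w
    · exact absurd hw Γ.irrefl
    · exact ⟨p, Nat.lt_succ_iff.1 p.2, (hv p).2 hw⟩
  · rintro (_ | p) (_ | q)
    · exact ⟨fun h => absurd h (Γ.irrefl), fun h => h.elim⟩
    · exact (hv q).symm
    · exact (Γ.adj_comm _ _).trans (hv p).symm
    · exact f.map_adj_iff

lemma inClassG_of_iso {V : Type*} {Γ : SimpleGraph V} {r : ℕ} {v : ℕ → Prop}
    (e : Γ ≃g coneGraph (r + 1) v) (hv : ∃ p ≤ r, v p) : InClassG Γ := by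
  constructor
  · rw [e.connected_iff, SimpleGraph.connected_iff_exists_forall_reachable]
    obtain ⟨p, hp, hvp⟩ := hv
    let φ : SimpleGraph.pathGraph (r + 1) →g coneGraph (r + 1) v := ⟨some, fun h => h⟩
    refine ⟨some ⟨p, Nat.lt_succ_of_le hp⟩, ?_⟩
    rintro (_ | q)
    · exact SimpleGraph.Adj.reachable hvp
    · exact ((SimpleGraph.pathGraph_connected r).preconnected _ q).map φ
  · refine ⟨e.symm none, r + 1, by omega, ⟨⟨Equiv.ofBijective
      (fun p => ⟨e.symm (some p), by simp⟩) ⟨fun p q h => ?_, ?_⟩, ?_⟩⟩⟩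
    · simpa using h
    · rintro ⟨y, hy⟩
      cases hey : e y with
      | none => exact absurd (by rw [← hey]; simp) hy
      | some p => exact ⟨p, Subtype.ext ((congrArg e.symm hey.symm).trans (e.symm_apply_apply y))⟩
    · intro p q
      exact e.symm.map_adj_iff

/-! ### The comparison of the counts as a condition on the sign sequence -/

/-- The sign sequence of the set `v` of positions, negative on `v`. -/
noncomputable def signSeq (v : ℕ → Prop) (k : ℕ) : ℤ := signTwo (indicatorTwo v k)

lemma signSeq_of_mem {v : ℕ → Prop} {k : ℕ} (h : v k) : signSeq v k = -1 := by
  simp [signSeq, indicatorTwo, signTwo, h]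

lemma signSeq_of_notMem {v : ℕ → Prop} {k : ℕ} (h : ¬ v k) : signSeq v k = 1 := by
  simp [signSeq, indicatorTwo, signTwo, h]

lemma abs_signSeq (v : ℕ → Prop) (k : ℕ) : |signSeq v k| = 1 := by
  by_cases h : v k
  · rw [signSeq_of_mem h]; rfl
  · rw [signSeq_of_notMem h]; rfl

lemma signedCount_eq_signedValue (w : ℕ → ZMod 2) (r : ℕ) :
    signedCount w 0 (r + 1) = signedValue (fun k => signTwo (w k)) r := by
  have key : ∀ r, transfer (fun k => signTwo (w (k + 1))) r (signTwo (w 0), 0) =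
      (signedCount w 0 (r + 1), signedCount w 0 r) := by
    intro r
    induction r with
    | zero => rw [transfer, zero_add, signedCount_zero_one, signedCount_zero_zero]
    | succ r ih => rw [transfer, ih, signedCount_zero_add_two]
  have h := congrArg Prod.fst (key r)
  rw [transfer_eq_smul_add_smul] at h
  simpa [signedValue] using h.symm

lemma three_mul_signedCount_zero (r : ℕ) :
    3 * signedCount 0 0 (r + 1) = 2 ^ (r + 1) + (-1) ^ r := by
  obtain ⟨h1, h2⟩ := transfer_of_pos (σ := fun _ => 1) (n := r) (fun _ _ => rfl) (1, 0)
  rw [signedCount_eq_signedValue, signedValue]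
  simp only [Pi.zero_apply, show signTwo 0 = 1 from rfl, one_mul] at h1 h2 ⊢
  rw [pow_succ]
  linear_combination 2 * h1 + h2

/-- The rank condition on a cone over a path in terms of the sign sequence of the neighbours of the
extra vertex: the reduction of the problem to the recurrence. -/
lemma rankCount_lt_iff_isLarge {V : Type*} [Fintype V] {Γ : SimpleGraph V} {r : ℕ}
    {v : ℕ → Prop} (e : Γ ≃g coneGraph (r + 1) v) :
    rankCount Γ (Fintype.card V) < rankCount Γ (Fintype.card V - 1) ↔ IsLarge (signSeq v) r := by
  have hcard : Fintype.card V = r + 2 := by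
    rw [Fintype.card_congr e.toEquiv, Fintype.card_option, Fintype.card_fin]
  rw [hcard, show r + 2 - 1 = r + 1 from rfl, show r + 2 = r + 1 + 1 from rfl, rankCount_congr e,
    rankCount_congr e]
  have h1 := two_mul_rankCount_sub (r + 1) v
  have h2 := three_mul_signedCount_zero r
  have h3 := signedCount_eq_signedValue (indicatorTwo v) r
  rw [IsLarge, ← h2]
  change _ = signedValue (signSeq v) r at h3
  rw [h3] at h1
  omega

lemma interiorNeg_signSeq_iff {v : ℕ → Prop} {r : ℕ} {C : ℕ → Prop} :
    InteriorNeg (signSeq v) r C ↔ ∀ k, 1 ≤ k → k < r → (v k ↔ C k) := by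
  refine forall_congr' fun k => forall_congr' fun _ => forall_congr' fun _ => ?_
  by_cases h : v k
  · rw [signSeq_of_mem h]
    simp [h]
  · rw [signSeq_of_notMem h]
    simp [h]

lemma signSeq_mul_eq_one_iff {v : ℕ → Prop} {a b : ℕ} :
    signSeq v a * signSeq v b = 1 ↔ (v a ∧ v b ∨ ¬ v a ∧ ¬ v b) := by
  by_cases ha : v a <;> by_cases hb : v b <;>
    simp [ha, hb, signSeq_of_mem, signSeq_of_notMem]

lemma signSeq_mul_eq_neg_one_iff {v : ℕ → Prop} {a b : ℕ} :
    signSeq v a * signSeq v b = -1 ↔ (v a ∧ ¬ v b ∨ ¬ v a ∧ v b) := by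
  by_cases ha : v a <;> by_cases hb : v b <;>
    simp [ha, hb, signSeq_of_mem, signSeq_of_notMem]

lemma isNbrPosition_singleton {a p : ℕ} : ¬ IsNbrPosition [a] p := by
  rintro ⟨i, hi, -⟩
  simp at hi

lemma isNbrPosition_cons_cons {a b p : ℕ} {l : List ℕ} :
    IsNbrPosition (a :: b :: l) p ↔ p = a ∨ ∃ q, IsNbrPosition (b :: l) q ∧ p = a + q := by
  constructor
  · rintro ⟨i, hi, rfl⟩
    rcases i with _ | i
    · left; simp
    · right
      exact ⟨_, ⟨i, by simpa using hi, rfl⟩, by simp⟩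
  · rintro (rfl | ⟨_, ⟨i, hi, rfl⟩, rfl⟩)
    · exact ⟨0, by simp, by simp⟩
    · exact ⟨i + 1, by simpa using hi, by simp⟩

lemma isNbrPosition_three {a b c p : ℕ} :
    IsNbrPosition [a, b, c] p ↔ p = a ∨ p = a + b := by
  simp [isNbrPosition_cons_cons, isNbrPosition_singleton]

lemma isNbrPosition_four {a b c d p : ℕ} :
    IsNbrPosition [a, b, c, d] p ↔ p = a ∨ p = a + b ∨ p = a + b + c := by
  simp only [isNbrPosition_cons_cons (b := b), isNbrPosition_three]
  constructor
  · rintro (h | ⟨q, h, rfl⟩) <;> omega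
  · rintro (h | h | h)
    · exact Or.inl h
    · exact Or.inr ⟨b, by omega, h⟩
    · exact Or.inr ⟨b + c, by omega, by omega⟩

lemma isNbrPosition_five {a b c d e p : ℕ} :
    IsNbrPosition [a, b, c, d, e] p ↔
      p = a ∨ p = a + b ∨ p = a + b + c ∨ p = a + b + c + d := by
  simp only [isNbrPosition_cons_cons (b := b), isNbrPosition_four]
  constructor
  · rintro (h | ⟨q, h, rfl⟩) <;> omega
  · intro h
    by_cases hp : p = a
    · exact Or.inl hp
    · exact Or.inr ⟨p - a, by omega, by omega⟩

lemma isNbrPosition_six {a b c d e f p : ℕ} :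
    IsNbrPosition [a, b, c, d, e, f] p ↔
      p = a ∨ p = a + b ∨ p = a + b + c ∨ p = a + b + c + d ∨ p = a + b + c + d + e := by
  simp only [isNbrPosition_cons_cons (b := b), isNbrPosition_five]
  constructor
  · rintro (h | ⟨q, h, rfl⟩) <;> omega
  · intro h
    by_cases hp : p = a
    · exact Or.inl hp
    · exact Or.inr ⟨p - a, by omega, by omega⟩

/-! ### The six families of graphs -/

lemma iff_of_interior {v C D : ℕ → Prop} {r : ℕ} (h : ∀ k, 1 ≤ k → k < r → (v k ↔ C k))
    (hCD : ∀ k, 1 ≤ k → k < r → (C k ↔ D k)) (h0 : v 0 ↔ D 0) (hr : v r ↔ D r) :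
    ∀ k ≤ r, (v k ↔ D k) := by
  intro k hk
  rcases (by omega : k = 0 ∨ k = r ∨ 1 ≤ k ∧ k < r) with rfl | rfl | ⟨h1, h2⟩
  · exact h0
  · exact hr
  · exact (h k h1 h2).trans (hCD k h1 h2)

lemma iff_reverse {v D E : ℕ → Prop} {r : ℕ} (h : ∀ k ≤ r, (v k ↔ D k))
    (hDE : ∀ k ≤ r, (D (r - k) ↔ E k)) : ∀ k ≤ r, (v (r - k) ↔ E k) :=
  fun k hk => (h _ (Nat.sub_le r k)).trans (hDE k hk)

/-- The patterns with exactly one negative end occur in two orientations, which are exchanged by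
reversing the path. -/
lemma exists_isGamma_of_isLarge {V : Type*} {Γ : SimpleGraph V} {r : ℕ} {v : ℕ → Prop}
    (e : Γ ≃g coneGraph (r + 1) v) (hv : ∃ p ≤ r, v p) (hl : IsLarge (signSeq v) r) :
    (∃ s t : ℕ, 1 ≤ s ∧ Even (min s t) ∧ IsGamma Γ [0, s, t]) ∨
      (∃ s t : ℕ, 1 ≤ s ∧ 1 ≤ t ∧ Even (min s t) ∧ IsGamma Γ [s, 2, t]) ∨
      (∃ s t : ℕ, 1 ≤ s ∧ Odd (min s t) ∧ IsGamma Γ [0, s, 1, t]) ∨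
      (∃ s t : ℕ, 1 ≤ s ∧ 1 ≤ t ∧ Even (min s t) ∧ IsGamma Γ [s, 1, 1, t]) ∨
      (∃ s t : ℕ, 1 ≤ s ∧ 1 ≤ t ∧ Even (min s t) ∧ IsGamma Γ [0, s, 2, t, 0]) ∨
      (∃ s t : ℕ, 1 ≤ s ∧ 1 ≤ t ∧ Even (min s t) ∧ IsGamma Γ [0, s, 1, 1, t, 0]) := by
  have hσ := abs_signSeq v
  rcases hl.interior_cases hσ with h | ⟨s, t, hs, ht, ⟨rfl, h⟩ | ⟨rfl, h⟩ | ⟨rfl, h⟩ | ⟨rfl, h⟩⟩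
  · left
    rcases Nat.eq_zero_or_pos r with rfl | hr
    · -- On a single vertex the value is `-1`.
      obtain ⟨p, hp, hvp⟩ := hv
      obtain rfl : p = 0 := by omega
      rw [IsLarge, signedValue, signSeq_of_mem hvp, transfer] at hl
      norm_num at hl
    have h1 := signSeq_mul_eq_one_iff.1 ((isLarge_interior_none hσ hr h).1 hl)
    rw [interiorNeg_signSeq_iff] at h
    have h2 : v 0 ∧ v r := by
      refine h1.resolve_right fun h1 => ?_
      obtain ⟨p, hp, hvp⟩ := hv
      rcases (by omega : p = 0 ∨ p = r ∨ 1 ≤ p ∧ p < r) with rfl | rfl | ⟨h3, h4⟩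
      · exact h1.1 hvp
      · exact h1.2 hvp
      · exact (h p h3 h4).1 hvp
    refine ⟨r, 0, hr, by simp, isGamma_of_iso e (by simp) (Or.inl ?_)⟩
    simp only [isNbrPosition_three]
    exact iff_of_interior h (fun k _ _ => iff_of_false id (by omega)) (by simp [h2]) (by simp [h2])
  · left
    obtain ⟨h1, h2⟩ := (isLarge_interior_single hσ hs ht h).1 hl
    rw [signSeq_mul_eq_neg_one_iff] at h1
    rw [interiorNeg_signSeq_iff] at h
    rcases h1 with ⟨h0, hr⟩ | ⟨h0, hr⟩
    · refine ⟨s, t, hs, h2, isGamma_of_iso e (by simp) (Or.inl ?_)⟩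
      simp only [isNbrPosition_three]
      exact iff_of_interior h (by omega) (by simp [h0]) (by simp only [hr, false_iff]; omega)
    · refine ⟨t, s, ht, by rwa [min_comm], isGamma_of_iso e (by simp [add_comm]) (Or.inr ?_)⟩
      simp only [isNbrPosition_three]
      exact iff_reverse (D := fun k => k = s ∨ k = s + t) (iff_of_interior h (by omega)
        (by simp only [h0, false_iff]; omega) (by simp [hr])) (by omega)
  · right; right; left
    obtain ⟨h1, h2⟩ := (isLarge_interior_double hσ hs ht h).1 hl
    rw [Nat.not_even_iff_odd] at h2
    rw [signSeq_mul_eq_neg_one_iff] at h1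
    rw [interiorNeg_signSeq_iff] at h
    rcases h1 with ⟨h0, hr⟩ | ⟨h0, hr⟩
    · refine ⟨s, t, hs, h2, isGamma_of_iso e (by simp [add_assoc]) (Or.inl ?_)⟩
      simp only [isNbrPosition_four]
      exact iff_of_interior h (by omega) (by simp [h0]) (by simp only [hr, false_iff]; omega)
    · refine ⟨t, s, ht, by rwa [min_comm], isGamma_of_iso e (by simp; omega) (Or.inr ?_)⟩
      simp only [isNbrPosition_four]
      exact iff_reverse (D := fun k => k = s ∨ k = s + 1 ∨ k = s + 1 + t) (iff_of_interior h
        (by omega) (by simp only [h0, false_iff]; omega) (by simp [hr])) (by omega)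
  · obtain ⟨h1, h2⟩ := (isLarge_interior_gap hσ hs ht h).1 hl
    rw [signSeq_mul_eq_one_iff] at h1
    rw [interiorNeg_signSeq_iff] at h
    rcases h1 with ⟨h0, hr⟩ | ⟨h0, hr⟩
    · right; right; right; right; left
      refine ⟨s, t, hs, ht, h2, isGamma_of_iso e (by simp; omega) (Or.inl ?_)⟩
      simp only [isNbrPosition_five]
      exact iff_of_interior h (by omega) (by simp [h0]) (by simp [hr])
    · right; left
      refine ⟨s, t, hs, ht, h2, isGamma_of_iso e (by simp; omega) (Or.inl ?_)⟩
      simp only [isNbrPosition_three]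
      exact iff_of_interior h (by omega) (by simp only [h0, false_iff]; omega)
        (by simp only [hr, false_iff]; omega)
  · obtain ⟨h1, h2⟩ := (isLarge_interior_triple hσ hs ht h).1 hl
    rw [signSeq_mul_eq_one_iff] at h1
    rw [interiorNeg_signSeq_iff] at h
    rcases h1 with ⟨h0, hr⟩ | ⟨h0, hr⟩
    · right; right; right; right; right
      refine ⟨s, t, hs, ht, h2, isGamma_of_iso e (by simp; omega) (Or.inl ?_)⟩
      simp only [isNbrPosition_six]
      exact iff_of_interior h (by omega) (by simp [h0])
        (by simp only [hr, true_iff]; omega)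
    · right; right; right; left
      refine ⟨s, t, hs, ht, h2, isGamma_of_iso e (by simp; omega) (Or.inl ?_)⟩
      simp only [isNbrPosition_four]
      exact iff_of_interior h (by omega) (by simp only [h0, false_iff]; omega)
        (by simp only [hr, false_iff]; omega)

lemma inClassG_and_rankCount_lt {V : Type*} [Fintype V] {Γ : SimpleGraph V} {t : List ℕ} {r : ℕ}
    (hΓ : IsGamma Γ t) (hr : t.sum = r) (ht : ∃ p ≤ r, IsNbrPosition t p)
    (hl : IsLarge (signSeq (IsNbrPosition t)) r) :
    InClassG Γ ∧ rankCount Γ (Fintype.card V) < rankCount Γ (Fintype.card V - 1) := by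
  subst hr
  rw [IsGamma, gapGraph_eq_coneGraph] at hΓ
  obtain ⟨e⟩ := hΓ
  exact ⟨inClassG_of_iso e ht, (rankCount_lt_iff_isLarge e).2 hl⟩

theorem theorem5 {V : Type*} [Fintype V] (Γ : SimpleGraph V) :
    (InClassG Γ ∧ rankCount Γ (Fintype.card V) < rankCount Γ (Fintype.card V - 1)) ↔
      ((∃ s t : ℕ, 1 ≤ s ∧ Even (min s t) ∧ IsGamma Γ [0, s, t]) ∨
        (∃ s t : ℕ, 1 ≤ s ∧ 1 ≤ t ∧ Even (min s t) ∧ IsGamma Γ [s, 2, t]) ∨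
        (∃ s t : ℕ, 1 ≤ s ∧ Odd (min s t) ∧ IsGamma Γ [0, s, 1, t]) ∨
        (∃ s t : ℕ, 1 ≤ s ∧ 1 ≤ t ∧ Even (min s t) ∧ IsGamma Γ [s, 1, 1, t]) ∨
        (∃ s t : ℕ, 1 ≤ s ∧ 1 ≤ t ∧ Even (min s t) ∧ IsGamma Γ [0, s, 2, t, 0]) ∨
        (∃ s t : ℕ, 1 ≤ s ∧ 1 ≤ t ∧ Even (min s t) ∧ IsGamma Γ [0, s, 1, 1, t, 0])) := by
  constructor
  · rintro ⟨h1, h2⟩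
    obtain ⟨r, v, hv, ⟨e⟩⟩ := h1.exists_iso_coneGraph
    exact exists_isGamma_of_isLarge e hv ((rankCount_lt_iff_isLarge e).1 h2)
  · rintro (⟨s, t, hs, hst, h⟩ | ⟨s, t, hs, ht, hst, h⟩ | ⟨s, t, hs, hst, h⟩ |
      ⟨s, t, hs, ht, hst, h⟩ | ⟨s, t, hs, ht, hst, h⟩ | ⟨s, t, hs, ht, hst, h⟩)
    · refine inClassG_and_rankCount_lt (r := s + t) h (by simp)
        ⟨0, by omega, isNbrPosition_three.2 (by omega)⟩ ?_
      rcases Nat.eq_zero_or_pos t with rfl | ht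
      · refine (isLarge_interior_none (abs_signSeq _) hs (interiorNeg_signSeq_iff.2 ?_)).2
          (signSeq_mul_eq_one_iff.2 ?_) <;> simp only [isNbrPosition_three] <;> grind
      · refine (isLarge_interior_single (abs_signSeq _) hs ht (interiorNeg_signSeq_iff.2 ?_)).2
          ⟨signSeq_mul_eq_neg_one_iff.2 ?_, hst⟩ <;> simp only [isNbrPosition_three] <;> grind
    · refine inClassG_and_rankCount_lt (r := s + 2 + t) h (by simp; omega)
        ⟨s, by omega, isNbrPosition_three.2 (by omega)⟩
        ((isLarge_interior_gap (abs_signSeq _) hs ht (interiorNeg_signSeq_iff.2 ?_)).2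
          ⟨signSeq_mul_eq_one_iff.2 ?_, hst⟩) <;> simp only [isNbrPosition_three] <;> grind
    · have ht : 1 ≤ t := by
        by_contra ht
        obtain rfl : t = 0 := by omega
        simp at hst
      refine inClassG_and_rankCount_lt (r := s + 1 + t) h (by simp; omega)
        ⟨0, by omega, isNbrPosition_four.2 (by omega)⟩
        ((isLarge_interior_double (abs_signSeq _) hs ht (interiorNeg_signSeq_iff.2 ?_)).2
          ⟨signSeq_mul_eq_neg_one_iff.2 ?_, Nat.not_even_iff_odd.2 hst⟩) <;>
        simp only [isNbrPosition_four] <;> grind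
    · refine inClassG_and_rankCount_lt (r := s + 2 + t) h (by simp; omega)
        ⟨s, by omega, isNbrPosition_four.2 (by omega)⟩
        ((isLarge_interior_triple (abs_signSeq _) hs ht (interiorNeg_signSeq_iff.2 ?_)).2
          ⟨signSeq_mul_eq_one_iff.2 ?_, hst⟩) <;> simp only [isNbrPosition_four] <;> grind
    · refine inClassG_and_rankCount_lt (r := s + 2 + t) h (by simp; omega)
        ⟨0, by omega, isNbrPosition_five.2 (by omega)⟩
        ((isLarge_interior_gap (abs_signSeq _) hs ht (interiorNeg_signSeq_iff.2 ?_)).2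
          ⟨signSeq_mul_eq_one_iff.2 ?_, hst⟩) <;> simp only [isNbrPosition_five] <;> grind
    · refine inClassG_and_rankCount_lt (r := s + 2 + t) h (by simp; omega)
        ⟨0, by omega, isNbrPosition_six.2 (by omega)⟩
        ((isLarge_interior_triple (abs_signSeq _) hs ht (interiorNeg_signSeq_iff.2 ?_)).2
          ⟨signSeq_mul_eq_one_iff.2 ?_, hst⟩) <;> simp only [isNbrPosition_six] <;> grind
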